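/- Let $(M,g)$ be a compact connected Hermitian manifold of complex dimension $n$, and fix finitely many holomorphic charts of $M$ together with compact subsets of their domains that cover $M$. For every real $K$ there exist constants $C_1,C_2,C_3$, depending only on $(M,g)$, the chosen charts and compact sets, and $K$, such that the following holds. Let $0<T\le\infty$ and let $g'=g'(t)$, $0<t<T$, be a family of Hermitian metrics on $M$, smooth on $M\times(0,T)$ (for instance $g'_{i\bar j}=g_{i\bar j}+\partial_i\partial_{\bar j}\varphi$ for a smooth function $\varphi$ on $M\times(0,T)$ for which this is positive definite), that is bounded by $K$ in the following sense: for all $t\in(0,T)$, $$g'(t)\le K g,\qquad g\le K g'(t),$$ and on the chosen compact sets, in the chosen coordinates, $$|\partial_k g'_{i\bar j}|\le K,\qquad |\partial_k\partial_{\bar l}\, g'_{i\bar j}|\le K,\qquad |\partial_t g'_{i\bar j}|\le K .$$ Let $u$ be a smooth positive function on $M\times(0,T)$ with $$\frac{\partial u}{\partial t}=g'^{i\bar j}\partial_i\partial_{\bar j}u .$$ Then for all $0<t_1<t_2<T$, $$\sup_{x\in M}u(x,t_1)\ \le\ \inf_{x\in M}u(x,t_2)\,\Big(\frac{t_2}{t_1}\Big)^{C_2}\exp\Big(\frac{C_3}{t_2-t_1}+C_1(t_2-t_1)\Big).$$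 -/

import Mathlib

open scoped Manifold ContDiff ComplexConjugate

namespace HermitianHarnack

noncomputable section

/-- The model space `ℂⁿ` of a complex manifold of complex dimension `n`. -/
abbrev Cn (n : ℕ) : Type := EuclideanSpace ℂ (Fin n)

/-- The Wirtinger derivative `∂h/∂zᵢ = (∂h/∂xᵢ - √-1 ∂h/∂yᵢ) / 2`, where `zᵢ = xᵢ + √-1 yᵢ`. -/
def dz {n : ℕ} (i : Fin n) (h : Cn n → ℂ) (z : Cn n) : ℂ :=
  (fderiv ℝ h z (EuclideanSpace.single i 1)
    - Complex.I * fderiv ℝ h z (EuclideanSpace.single i Complex.I)) / 2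

/-- The Wirtinger derivative `∂h/∂z̄ᵢ = (∂h/∂xᵢ + √-1 ∂h/∂yᵢ) / 2`. -/
def dzbar {n : ℕ} (i : Fin n) (h : Cn n → ℂ) (z : Cn n) : ℂ :=
  (fderiv ℝ h z (EuclideanSpace.single i 1)
    + Complex.I * fderiv ℝ h z (EuclideanSpace.single i Complex.I)) / 2

section Metric

variable {n : ℕ} {M : Type*} [TopologicalSpace M] [ChartedSpace (Cn n) M]

/-- The coordinate vector field `∂/∂zᵢ` of a chart `e`, at the point with coordinates `z`,
as an element of the (holomorphic) tangent space. -/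
def coordVector (e : OpenPartialHomeomorph M (Cn n)) (z : Cn n) (i : Fin n) :
    TangentSpace 𝓘(ℂ, Cn n) (e.symm z) :=
  mfderiv 𝓘(ℂ, Cn n) 𝓘(ℂ, Cn n) e.symm z (EuclideanSpace.single i (1 : ℂ) : Cn n)

/-- The matrix `g_{i j̄}` of a field of sesquilinear forms (linear in the first argument,
conjugate linear in the second) in a chart `e`, at the point with coordinates `z`. -/
def formCoeff
    (g : ∀ x : M, TangentSpace 𝓘(ℂ, Cn n) x →ₗ[ℂ] TangentSpace 𝓘(ℂ, Cn n) x →ₗ⋆[ℂ] ℂ)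
    (e : OpenPartialHomeomorph M (Cn n)) (z : Cn n) : Matrix (Fin n) (Fin n) ℂ :=
  Matrix.of fun i j => g (e.symm z) (coordVector e z i) (coordVector e z j)

variable (n M) in
/-- A smooth Hermitian metric on a complex manifold. -/
structure HermitianMetric where
  /-- The form on each tangent space: linear in the first argument, conjugate linear in the
  second. -/
  form : ∀ x : M, TangentSpace 𝓘(ℂ, Cn n) x →ₗ[ℂ] TangentSpace 𝓘(ℂ, Cn n) x →ₗ⋆[ℂ] ℂ
  conj_symm : ∀ x v w, conj (form x v w) = form x w v
  pos : ∀ x v, v ≠ 0 → 0 < (form x v v).re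
  smooth : ∀ e ∈ atlas (Cn n) M, ∀ i j,
    ContDiffOn ℝ ∞ (fun z => formCoeff form e z i j) e.target

/-- The components `g_{i j̄}` in the chart `e`, at the point with coordinates `z`. -/
def HermitianMetric.coeff (g : HermitianMetric n M) (e : OpenPartialHomeomorph M (Cn n))
    (z : Cn n) : Matrix (Fin n) (Fin n) ℂ :=
  formCoeff g.form e z

/-- The squared length `|v|²_g = g(v, v̄)` of a tangent vector. -/
def HermitianMetric.normSq (g : HermitianMetric n M) (x : M)
    (v : TangentSpace 𝓘(ℂ, Cn n) x) : ℝ :=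
  (g.form x v v).re

/-- The complex Laplacian `g^{i j̄} ∂ᵢ ∂_{j̄} h` of a real function `h` on `M`, in the chart `e`, at
the point with coordinates `z`. The convention `g^{i j̄} g_{k j̄} = δ_{ik}` means that `g^{i j̄}`
is the `(j, i)` entry of the inverse of the matrix `(g_{i j̄})`. -/
def HermitianMetric.laplacian (g : HermitianMetric n M) (e : OpenPartialHomeomorph M (Cn n))
    (h : M → ℝ) (z : Cn n) : ℂ :=
  ∑ i, ∑ j, (g.coeff e z)⁻¹ j i * dz i (dzbar j fun w => ((h (e.symm w) : ℝ) : ℂ)) z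

/-- The open time interval `(0, T)`, where `T` may be `∞`. -/
def timeInterval (T : EReal) : Set ℝ := {t : ℝ | 0 < t ∧ (t : EReal) < T}

/-- The family of metrics `g'(t)`, `0 < t < T`, is smooth in space and time together. -/
def SmoothFamily (g' : ℝ → HermitianMetric n M) (T : EReal) : Prop :=
  ∀ e ∈ atlas (Cn n) M, ∀ i j,
    ContDiffOn ℝ ∞ (fun p : Cn n × ℝ => (g' p.2).coeff e p.1 i j) (e.target ×ˢ timeInterval T)

variable (n M) in
/-- Finitely many holomorphic charts with compact sets inside their domains that cover `M`: the
data in which bounds for the derivatives of a tensor are measured. -/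
structure CoordCover where
  N : ℕ
  chart : Fin N → OpenPartialHomeomorph M (Cn n)
  chart_mem : ∀ a, chart a ∈ atlas (Cn n) M
  piece : Fin N → Set M
  isCompact_piece : ∀ a, IsCompact (piece a)
  piece_subset : ∀ a, piece a ⊆ (chart a).source
  cover : ⋃ a, piece a = Set.univ

/-- The metrics `g'(t)`, `0 < t < T`, are bounded by `K`: they are uniformly equivalent to the fixed
metric `g`, and the derivatives `∂ₖ g'_{i j̄}`, `∂ₖ ∂_{l̄} g'_{i j̄}` and `∂ₜ g'_{i j̄}` in the
coordinates of the cover are at most `K`. -/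
structure MetricBound (g : HermitianMetric n M) (𝒰 : CoordCover n M)
    (g' : ℝ → HermitianMetric n M) (T : EReal) (K : ℝ) : Prop where
  upper : ∀ t ∈ timeInterval T, ∀ x v, (g' t).normSq x v ≤ K * g.normSq x v
  lower : ∀ t ∈ timeInterval T, ∀ x v, g.normSq x v ≤ K * (g' t).normSq x v
  space_deriv : ∀ t ∈ timeInterval T, ∀ a, ∀ x ∈ 𝒰.piece a, ∀ i j k,
    ‖dz k (fun w => (g' t).coeff (𝒰.chart a) w i j) (𝒰.chart a x)‖ ≤ K
  space_deriv_two : ∀ t ∈ timeInterval T, ∀ a, ∀ x ∈ 𝒰.piece a, ∀ i j k l,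
    ‖dz k (dzbar l fun w => (g' t).coeff (𝒰.chart a) w i j) (𝒰.chart a x)‖ ≤ K
  time_deriv : ∀ t ∈ timeInterval T, ∀ a, ∀ x ∈ 𝒰.piece a, ∀ i j,
    ‖deriv (fun s => (g' s).coeff (𝒰.chart a) (𝒰.chart a x) i j) t‖ ≤ K

/-- `u` is a smooth positive solution of `u_t = g'^{i j̄} u_{i j̄}` on `M × (0, T)`. -/
structure IsPositiveSolution (g' : ℝ → HermitianMetric n M) (T : EReal) (u : M → ℝ → ℝ) :
    Prop where
  smooth : ∀ e ∈ atlas (Cn n) M,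
    ContDiffOn ℝ ∞ (fun p : Cn n × ℝ => u (e.symm p.1) p.2) (e.target ×ˢ timeInterval T)
  pos : ∀ x, ∀ t ∈ timeInterval T, 0 < u x t
  equation : ∀ e ∈ atlas (Cn n) M, ∀ z ∈ e.target, ∀ t ∈ timeInterval T,
    ((deriv (fun s => u (e.symm z) s) t : ℝ) : ℂ) = (g' t).laplacian e (fun x => u x t) z

end Metric

end

end HermitianHarnack

/-! This is the Li–Yau method, carried out in coordinates instead of with a connection. Put `f = log
u` and `L = g'^{i j̄} ∂ᵢ ∂_{j̄}`. Then `f_t = L f + |∂f|²`, and the quantity to bound is `G = |∂f|²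
- 2 f_t`. The equation gives `|∂f|² + G = -2 L f`, so a large `G` forces a large Hessian.

In real coordinates `L = ∑ aₖₗ Dₖ Dₗ` with `a` uniformly elliptic. At a spatial critical point of
`G` all third derivatives and mixed time derivatives of `f` cancel from `L G - G_t`
(`evolution_harnackQuantity`). What is left is at least `2c²|D²f|² - N(|Df|² + |Df||D²f| + |D²f|)`
(`le_evolutionRHS`), where `N` uses only bounds on `a`, `Da`, `La` and `a_t`. At a space-time
maximum of `(t - ε) G` one has `L G - G_t ≤ G / (t - ε)`. Since `|D²f|` controls `|∂f|² + G`, the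
quadratic terms absorb the errors (`exists_harnack_constants`), and `G ≤ C / t + B` on all of `M`
(`exists_manifoldHarnack_le`). The factor 2 in `G`, rather than 1, supplies the `|∂f|⁴` that absorbs
the `|Df|²` error.

The hypotheses on `g'` bound only mixed second derivatives. They suffice because second derivatives
of the inverse matrix are needed only through `L`, and `L(g'⁻¹)` involves those of `g'` only as `L
g'` (`ellOp_ringInverse`, `exists_coefficient_bound`).

The maximum is taken on `M`, so `|∂f|²` must not depend on the chart: it is the maximum over tangent
vectors `w` of `df(w) - g'(w, w)` (`isGreatest_gradSq`, `gradSq_chart_eq`). The same description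
serves as the Young inequality when `f` is integrated along a space-time segment
(`log_le_of_gradient_estimate`). This gives the Harnack inequality locally; chaining by
connectedness and compactness of `M × M` make it uniform (`exists_uniform_harnack`). -/

namespace HermitianHarnack

noncomputable section

/-! ### Calculus of directional derivatives of smooth functions on open sets -/

section DirectionalDerivative

variable {E F : Type*} [NormedAddCommGroup E] [NormedSpace ℝ E] [NormedAddCommGroup F]
  [NormedSpace ℝ F] {Ω : Set E} {p : E} {f h : E → F}

/-- The derivative of `h` in the direction `v`, as a function. -/
def dirDeriv (v : E) (h : E → F) (p : E) : F := fderiv ℝ h p v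

theorem contDiffOn_dirDeriv (hΩ : IsOpen Ω) (hh : ContDiffOn ℝ ∞ h Ω) (v : E) :
    ContDiffOn ℝ ∞ (dirDeriv v h) Ω :=
  (hh.fderiv_of_isOpen hΩ (by simp)).clm_apply contDiffOn_const

theorem differentiableAt_of_contDiffOn (hΩ : IsOpen Ω) (hh : ContDiffOn ℝ ∞ h Ω) (hp : p ∈ Ω) :
    DifferentiableAt ℝ h p :=
  (hh.contDiffAt (hΩ.mem_nhds hp)).differentiableAt (by simp)

theorem dirDeriv_congr (hΩ : IsOpen Ω) (hfh : ∀ q ∈ Ω, f q = h q) (hp : p ∈ Ω) (v : E) :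
    dirDeriv v f p = dirDeriv v h p := by
  have : f =ᶠ[nhds p] h := Filter.eventually_of_mem (hΩ.mem_nhds hp) hfh
  simp only [dirDeriv, this.fderiv_eq]

theorem dirDeriv_add (hΩ : IsOpen Ω) (hf : ContDiffOn ℝ ∞ f Ω) (hh : ContDiffOn ℝ ∞ h Ω)
    (hp : p ∈ Ω) (v : E) :
    dirDeriv v (fun q => f q + h q) p = dirDeriv v f p + dirDeriv v h p := by
  simp only [dirDeriv, fderiv_fun_add (differentiableAt_of_contDiffOn hΩ hf hp)
    (differentiableAt_of_contDiffOn hΩ hh hp), add_apply]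

theorem dirDeriv_sub (hΩ : IsOpen Ω) (hf : ContDiffOn ℝ ∞ f Ω) (hh : ContDiffOn ℝ ∞ h Ω)
    (hp : p ∈ Ω) (v : E) :
    dirDeriv v (fun q => f q - h q) p = dirDeriv v f p - dirDeriv v h p := by
  simp only [dirDeriv, fderiv_fun_sub (differentiableAt_of_contDiffOn hΩ hf hp)
    (differentiableAt_of_contDiffOn hΩ hh hp), sub_apply]

theorem dirDeriv_sum {κ : Type*} {s : Finset κ} {A : κ → E → F} (hΩ : IsOpen Ω)
    (hA : ∀ i ∈ s, ContDiffOn ℝ ∞ (A i) Ω) (hp : p ∈ Ω) (v : E) :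
    dirDeriv v (fun q => ∑ i ∈ s, A i q) p = ∑ i ∈ s, dirDeriv v (A i) p := by
  simp only [dirDeriv]
  rw [fderiv_fun_sum fun i hi => differentiableAt_of_contDiffOn hΩ (hA i hi) hp]
  simp

theorem dirDeriv_mul {𝔸 : Type*} [NormedRing 𝔸] [NormedAlgebra ℝ 𝔸] {f h : E → 𝔸}
    (hΩ : IsOpen Ω) (hf : ContDiffOn ℝ ∞ f Ω) (hh : ContDiffOn ℝ ∞ h Ω) (hp : p ∈ Ω) (v : E) :
    dirDeriv v (fun q => f q * h q) p = dirDeriv v f p * h p + f p * dirDeriv v h p := by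
  simp only [dirDeriv, fderiv_fun_mul' (differentiableAt_of_contDiffOn hΩ hf hp)
    (differentiableAt_of_contDiffOn hΩ hh hp)]
  simp [add_comm]

theorem dirDeriv_clm {G : Type*} [NormedAddCommGroup G] [NormedSpace ℝ G] (L : F →L[ℝ] G)
    (hΩ : IsOpen Ω) (hf : ContDiffOn ℝ ∞ f Ω) (hp : p ∈ Ω) (v : E) :
    dirDeriv v (fun q => L (f q)) p = L (dirDeriv v f p) := by
  have := (L.hasFDerivAt.comp p (differentiableAt_of_contDiffOn hΩ hf hp).hasFDerivAt).fderiv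
  simp only [dirDeriv]
  change fderiv ℝ (L ∘ f) p v = _
  rw [this]; rfl

theorem dirDeriv_const_mul {𝔸 : Type*} [NormedRing 𝔸] [NormedAlgebra ℝ 𝔸] {c : 𝔸} {f : E → 𝔸}
    (hΩ : IsOpen Ω) (hf : ContDiffOn ℝ ∞ f Ω) (hp : p ∈ Ω) (v : E) :
    dirDeriv v (fun q => c * f q) p = c * dirDeriv v f p :=
  dirDeriv_clm (ContinuousLinearMap.mul ℝ 𝔸 c) hΩ hf hp v

theorem dirDeriv_comm (hΩ : IsOpen Ω) (hh : ContDiffOn ℝ ∞ h Ω) (hp : p ∈ Ω) (v w : E) :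
    dirDeriv v (dirDeriv w h) p = dirDeriv w (dirDeriv v h) p := by
  have hc := hh.contDiffAt (hΩ.mem_nhds hp)
  have hs : IsSymmSndFDerivAt ℝ h p :=
    hc.isSymmSndFDerivAt (by
      rw [minSmoothness_of_isRCLikeNormedField]; exact WithTop.coe_le_coe.2 le_top)
  have key : ∀ a b : E, dirDeriv a (dirDeriv b h) p = fderiv ℝ (fderiv ℝ h) p a b := by
    intro a b
    have hd : DifferentiableAt ℝ (fderiv ℝ h) p :=
      differentiableAt_of_contDiffOn hΩ (hh.fderiv_of_isOpen hΩ (by simp)) hp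
    simp only [dirDeriv]
    change fderiv ℝ (fun q => fderiv ℝ h q b) p a = _
    rw [fderiv_clm_apply hd (differentiableAt_const b)]
    simp
  rw [key, key]
  exact hs v w

end DirectionalDerivative

/-! ### Second order operators and derivatives of the squared gradient -/

section LiYau

variable {E ι : Type*} [NormedAddCommGroup E] [NormedSpace ℝ E] [Fintype ι] {Ω : Set E} {p : E}

/-- The second order operator `∑ aₖₗ Dₖ Dₗ`, where `Dₖ` is the derivative in direction `b k`. -/
def ellOp {F : Type*} [NormedAddCommGroup F] [NormedSpace ℝ F] (b : ι → E) (a : ι → ι → E → ℝ)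
    (h : E → F) (p : E) : F :=
  ∑ k, ∑ l, a k l p • dirDeriv (b k) (dirDeriv (b l) h) p

/-- The squared gradient `∑ aᵢⱼ Dᵢf Dⱼf`. -/
def gradSq (b : ι → E) (a : ι → ι → E → ℝ) (f : E → ℝ) (p : E) : ℝ :=
  ∑ i, ∑ j, a i j p * dirDeriv (b i) f p * dirDeriv (b j) f p

variable {b : ι → E} {τ : E} {a : ι → ι → E → ℝ} {f : E → ℝ}

theorem contDiffOn_gradSq (hΩ : IsOpen Ω) (ha : ∀ i j, ContDiffOn ℝ ∞ (a i j) Ω)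
    (hf : ContDiffOn ℝ ∞ f Ω) : ContDiffOn ℝ ∞ (gradSq b a f) Ω := by
  unfold gradSq
  exact ContDiffOn.sum fun i _ => ContDiffOn.sum fun j _ =>
    ((ha i j).mul (contDiffOn_dirDeriv hΩ hf _)).mul (contDiffOn_dirDeriv hΩ hf _)

theorem dirDeriv_mul_mul {x y z : E → ℝ} (hΩ : IsOpen Ω) (hx : ContDiffOn ℝ ∞ x Ω)
    (hy : ContDiffOn ℝ ∞ y Ω) (hz : ContDiffOn ℝ ∞ z Ω) (hp : p ∈ Ω) (v : E) :
    dirDeriv v (fun q => x q * y q * z q) p =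
      dirDeriv v x p * y p * z p + x p * dirDeriv v y p * z p + x p * y p * dirDeriv v z p := by
  rw [dirDeriv_mul (f := fun q => x q * y q) hΩ (hx.mul hy) hz hp, dirDeriv_mul hΩ hx hy hp]
  ring

theorem dirDeriv_gradSq (hΩ : IsOpen Ω) (ha : ∀ i j, ContDiffOn ℝ ∞ (a i j) Ω)
    (hf : ContDiffOn ℝ ∞ f Ω) (hp : p ∈ Ω) (v : E) :
    dirDeriv v (gradSq b a f) p = ∑ i, ∑ j,
      (dirDeriv v (a i j) p * dirDeriv (b i) f p * dirDeriv (b j) f p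
        + a i j p * dirDeriv v (dirDeriv (b i) f) p * dirDeriv (b j) f p
        + a i j p * dirDeriv (b i) f p * dirDeriv v (dirDeriv (b j) f) p) := by
  have hD := fun i => contDiffOn_dirDeriv hΩ hf (b i)
  unfold gradSq
  rw [dirDeriv_sum hΩ (fun i _ => ContDiffOn.sum fun j _ => ((ha i j).mul (hD i)).mul (hD j)) hp]
  refine Finset.sum_congr rfl fun i _ => ?_
  rw [dirDeriv_sum hΩ (fun j _ => ((ha i j).mul (hD i)).mul (hD j)) hp]
  refine Finset.sum_congr rfl fun j _ => ?_
  rw [dirDeriv_mul_mul hΩ (ha i j) (hD i) (hD j) hp]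

theorem dirDeriv_dirDeriv_gradSq (hΩ : IsOpen Ω) (ha : ∀ i j, ContDiffOn ℝ ∞ (a i j) Ω)
    (hf : ContDiffOn ℝ ∞ f Ω) (hp : p ∈ Ω) (v w : E) :
    dirDeriv v (dirDeriv w (gradSq b a f)) p = ∑ i, ∑ j,
      (dirDeriv v (dirDeriv w (a i j)) p * dirDeriv (b i) f p * dirDeriv (b j) f p
        + (dirDeriv w (a i j) p * dirDeriv v (dirDeriv (b i) f) p * dirDeriv (b j) f p
          + dirDeriv w (a i j) p * dirDeriv (b i) f p * dirDeriv v (dirDeriv (b j) f) p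
          + dirDeriv v (a i j) p * dirDeriv w (dirDeriv (b i) f) p * dirDeriv (b j) f p
          + dirDeriv v (a i j) p * dirDeriv (b i) f p * dirDeriv w (dirDeriv (b j) f) p)
        + (a i j p * dirDeriv w (dirDeriv (b i) f) p * dirDeriv v (dirDeriv (b j) f) p
          + a i j p * dirDeriv v (dirDeriv (b i) f) p * dirDeriv w (dirDeriv (b j) f) p)
        + (a i j p * dirDeriv v (dirDeriv w (dirDeriv (b i) f)) p * dirDeriv (b j) f p
          + a i j p * dirDeriv (b i) f p * dirDeriv v (dirDeriv w (dirDeriv (b j) f)) p)) := by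
  have hD := fun i => contDiffOn_dirDeriv hΩ hf (b i)
  have hDD := fun i => contDiffOn_dirDeriv hΩ (hD i) w
  have hDa := fun i j => contDiffOn_dirDeriv hΩ (ha i j) w
  have h1 := fun i j => ((hDa i j).mul (hD i)).mul (hD j)
  have h2 := fun i j => ((ha i j).mul (hDD i)).mul (hD j)
  have h3 := fun i j => ((ha i j).mul (hD i)).mul (hDD j)
  rw [dirDeriv_congr hΩ (fun q hq => dirDeriv_gradSq hΩ ha hf hq w) hp v]
  rw [dirDeriv_sum hΩ (fun i _ => ContDiffOn.sum fun j _ => ((h1 i j).add (h2 i j)).add (h3 i j))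
    hp]
  refine Finset.sum_congr rfl fun i _ => ?_
  rw [dirDeriv_sum hΩ (fun j _ => ((h1 i j).add (h2 i j)).add (h3 i j)) hp]
  refine Finset.sum_congr rfl fun j _ => ?_
  have e1 := dirDeriv_add hΩ ((h1 i j).add (h2 i j)) (h3 i j) hp v
  have e2 := dirDeriv_add hΩ (h1 i j) (h2 i j) hp v
  have e3 := dirDeriv_mul_mul hΩ (hDa i j) (hD i) (hD j) hp v
  have e4 := dirDeriv_mul_mul hΩ (ha i j) (hDD i) (hD j) hp v
  have e5 := dirDeriv_mul_mul hΩ (ha i j) (hD i) (hDD j) hp v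
  rw [e1, e2, e3, e4, e5]
  ring

/-- Commuting `ellOp` with a directional derivative. -/
theorem ellOp_dirDeriv (hΩ : IsOpen Ω) (ha : ∀ i j, ContDiffOn ℝ ∞ (a i j) Ω)
    (hf : ContDiffOn ℝ ∞ f Ω) (hp : p ∈ Ω) (v : E) :
    ellOp b a (dirDeriv v f) p = dirDeriv v (ellOp b a f) p
      - ∑ k, ∑ l, dirDeriv v (a k l) p * dirDeriv (b k) (dirDeriv (b l) f) p := by
  have hDD := fun k l => contDiffOn_dirDeriv hΩ (contDiffOn_dirDeriv hΩ hf (b l)) (b k)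
  have e : dirDeriv v (ellOp b a f) p = ∑ k, ∑ l,
      (dirDeriv v (a k l) p * dirDeriv (b k) (dirDeriv (b l) f) p
        + a k l p * dirDeriv v (dirDeriv (b k) (dirDeriv (b l) f)) p) := by
    unfold ellOp
    simp only [smul_eq_mul]
    rw [dirDeriv_sum hΩ (fun k _ => ContDiffOn.sum fun l _ => (ha k l).mul (hDD k l)) hp]
    refine Finset.sum_congr rfl fun k _ => ?_
    rw [dirDeriv_sum hΩ (fun l _ => (ha k l).mul (hDD k l)) hp]
    exact Finset.sum_congr rfl fun l _ => dirDeriv_mul hΩ (ha k l) (hDD k l) hp v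
  rw [e]
  simp only [Finset.sum_add_distrib, add_sub_cancel_left]
  unfold ellOp
  refine Finset.sum_congr rfl fun k _ => Finset.sum_congr rfl fun l _ => ?_
  rw [dirDeriv_congr hΩ (fun q hq => dirDeriv_comm hΩ hf hq (b l) v) hp (b k),
    dirDeriv_comm hΩ (contDiffOn_dirDeriv hΩ hf (b l)) hp (b k) v, smul_eq_mul]

end LiYau

/-! ### Evolution of the Harnack quantity -/

section LiYauIdentity

variable {E ι : Type*} [NormedAddCommGroup E] [NormedSpace ℝ E] [Fintype ι] {Ω : Set E} {p : E}
  {b : ι → E} {τ : E} {a : ι → ι → E → ℝ} {f : E → ℝ}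

/-- The Harnack quantity `|∇f|² - 2 f_t`. -/
def harnackQuantity (b : ι → E) (τ : E) (a : ι → ι → E → ℝ) (f : E → ℝ) (q : E) : ℝ :=
  gradSq b a f q - 2 * dirDeriv τ f q

theorem contDiffOn_harnackQuantity (hΩ : IsOpen Ω) (ha : ∀ i j, ContDiffOn ℝ ∞ (a i j) Ω)
    (hf : ContDiffOn ℝ ∞ f Ω) : ContDiffOn ℝ ∞ (harnackQuantity b τ a f) Ω :=
  (contDiffOn_gradSq hΩ ha hf).sub (contDiffOn_const.mul (contDiffOn_dirDeriv hΩ hf τ))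

theorem dirDeriv_harnackQuantity (hΩ : IsOpen Ω) (ha : ∀ i j, ContDiffOn ℝ ∞ (a i j) Ω)
    (hf : ContDiffOn ℝ ∞ f Ω) (hp : p ∈ Ω) (v : E) :
    dirDeriv v (harnackQuantity b τ a f) p =
      dirDeriv v (gradSq b a f) p - 2 * dirDeriv v (dirDeriv τ f) p := by
  have hw := contDiffOn_dirDeriv hΩ hf τ
  unfold harnackQuantity
  rw [dirDeriv_sub hΩ (contDiffOn_gradSq hΩ ha hf) (contDiffOn_const.mul hw) hp,
    dirDeriv_const_mul hΩ hw hp]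

theorem ellOp_harnackQuantity (hΩ : IsOpen Ω) (ha : ∀ i j, ContDiffOn ℝ ∞ (a i j) Ω)
    (hf : ContDiffOn ℝ ∞ f Ω) (hp : p ∈ Ω) :
    ellOp b a (harnackQuantity b τ a f) p =
      ellOp b a (gradSq b a f) p - 2 * ellOp b a (dirDeriv τ f) p := by
  have hw := contDiffOn_dirDeriv hΩ hf τ
  have hP := contDiffOn_gradSq (b := b) hΩ ha hf
  have hkl : ∀ k l, dirDeriv (b k) (dirDeriv (b l) (harnackQuantity b τ a f)) p =
      dirDeriv (b k) (dirDeriv (b l) (gradSq b a f)) p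
        - 2 * dirDeriv (b k) (dirDeriv (b l) (dirDeriv τ f)) p := by
    intro k l
    rw [dirDeriv_congr hΩ (fun q hq => dirDeriv_harnackQuantity hΩ ha hf hq (b l)) hp,
      dirDeriv_sub hΩ (contDiffOn_dirDeriv hΩ hP _)
        (contDiffOn_const.mul (contDiffOn_dirDeriv hΩ hw _)) hp,
      dirDeriv_const_mul hΩ (contDiffOn_dirDeriv hΩ hw _) hp]
  simp only [ellOp, hkl, smul_eq_mul, Finset.mul_sum, ← Finset.sum_sub_distrib]
  exact Finset.sum_congr rfl fun k _ => Finset.sum_congr rfl fun l _ => by ring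

theorem sum_sum_mul_sum_sum_comm (c : ι → ι → ℝ) (F : ι → ι → ι → ι → ℝ) :
    ∑ k, ∑ l, c k l * ∑ i, ∑ j, F k l i j = ∑ i, ∑ j, ∑ k, ∑ l, c k l * F k l i j := by
  simp only [Finset.mul_sum]
  calc _ = ∑ k, ∑ i, ∑ l, ∑ j, c k l * F k l i j :=
        Finset.sum_congr rfl fun k _ => Finset.sum_comm
    _ = ∑ i, ∑ k, ∑ j, ∑ l, c k l * F k l i j := by
        rw [Finset.sum_comm]
        exact Finset.sum_congr rfl fun k _ => Finset.sum_congr rfl fun l _ => Finset.sum_comm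
    _ = _ := Finset.sum_congr rfl fun k _ => Finset.sum_comm

/-- The right hand side of the evolution equation of the Harnack quantity at a critical point, as
a function of the coefficients `A`, their derivatives `L = ∑ aₖₗ Dₖ Dₗ a`, `D`, `A'` and the first
and second derivatives `x`, `y` of the solution. -/
def evolutionRHS (A L : ι → ι → ℝ) (D : ι → ι → ι → ℝ) (A' : ι → ι → ℝ) (x : ι → ℝ)
    (y : ι → ι → ℝ) : ℝ :=
  (∑ i, ∑ j, L i j * x i * x j)
    + (∑ k, ∑ l, A k l * ∑ i, ∑ j, (D l i j * y k i * x j + D l i j * x i * y k j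
        + D k i j * y l i * x j + D k i j * x i * y l j))
    + (∑ k, ∑ l, A k l * ∑ i, ∑ j, (A i j * y l i * y k j + A i j * y k i * y l j))
    - (∑ i, ∑ j, A i j * ((∑ k, ∑ l, D i k l * y k l) * x j
        + x i * ∑ k, ∑ l, D j k l * y k l))
    + (∑ i, ∑ j, A' i j * x i * x j) + 2 * ∑ k, ∑ l, A' k l * y k l

/-- A Bochner-type computation. Third derivatives enter through `L fᵢ`, which equals `Dᵢ(L f)` up to
terms in `Da * D²f`. The equation gives `Dᵢ(L f) = Dᵢ f_t - Dᵢ|∂f|²`, and criticality `Dᵢ|∂f|² = 2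
Dᵢ f_t` turns this into `-Dᵢ f_t`. Likewise `-2 L f_t` leaves `+∂ₜ|∂f|²` after cancellation with
`-G_t`, and its mixed terms cancel the former ones. -/
theorem evolution_harnackQuantity (hΩ : IsOpen Ω) (ha : ∀ i j, ContDiffOn ℝ ∞ (a i j) Ω)
    (hf : ContDiffOn ℝ ∞ f Ω) (hp : p ∈ Ω)
    (heq : ∀ q ∈ Ω, dirDeriv τ f q = ellOp b a f q + gradSq b a f q)
    (hcrit : ∀ k, dirDeriv (b k) (harnackQuantity b τ a f) p = 0) :
    ellOp b a (harnackQuantity b τ a f) p - dirDeriv τ (harnackQuantity b τ a f) p =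
      evolutionRHS (fun i j => a i j p) (fun i j => ellOp b a (a i j) p)
        (fun k i j => dirDeriv (b k) (a i j) p) (fun i j => dirDeriv τ (a i j) p)
        (fun i => dirDeriv (b i) f p) (fun i j => dirDeriv (b i) (dirDeriv (b j) f) p) := by
  have hw := contDiffOn_dirDeriv hΩ hf τ
  have hP := contDiffOn_gradSq (b := b) hΩ ha hf
  have hell : ∀ v, dirDeriv v (ellOp b a f) p =
      dirDeriv v (dirDeriv τ f) p - dirDeriv v (gradSq b a f) p := by
    intro v
    rw [← dirDeriv_sub hΩ hw hP hp]
    exact dirDeriv_congr hΩ (fun q hq => by rw [heq q hq]; ring) hp v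
  have hcrit' : ∀ k, dirDeriv (b k) (gradSq b a f) p = 2 * dirDeriv (b k) (dirDeriv τ f) p := by
    intro k
    have := hcrit k
    rw [dirDeriv_harnackQuantity hΩ ha hf hp] at this
    linarith
  have hT : ∀ i, ellOp b a (dirDeriv (b i) f) p = - dirDeriv τ (dirDeriv (b i) f) p
      - ∑ k, ∑ l, dirDeriv (b i) (a k l) p * dirDeriv (b k) (dirDeriv (b l) f) p := by
    intro i
    rw [ellOp_dirDeriv hΩ ha hf hp, hell, hcrit', dirDeriv_comm hΩ hf hp τ (b i)]
    ring
  -- The third derivatives are regrouped as `L` applied to first derivatives, the form in which `hT`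
  -- eliminates them.
  have hcomm : ∑ k, ∑ l, a k l p * ∑ i, ∑ j,
      (a i j p * dirDeriv (b k) (dirDeriv (b l) (dirDeriv (b i) f)) p * dirDeriv (b j) f p
        + a i j p * dirDeriv (b i) f p * dirDeriv (b k) (dirDeriv (b l) (dirDeriv (b j) f)) p)
      = ∑ i, ∑ j, (a i j p * ellOp b a (dirDeriv (b i) f) p * dirDeriv (b j) f p
        + a i j p * dirDeriv (b i) f p * ellOp b a (dirDeriv (b j) f) p) := by
    rw [sum_sum_mul_sum_sum_comm]
    refine Finset.sum_congr rfl fun i _ => Finset.sum_congr rfl fun j _ => ?_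
    simp only [ellOp, smul_eq_mul, Finset.mul_sum, Finset.sum_mul, ← Finset.sum_add_distrib]
    exact Finset.sum_congr rfl fun k _ => Finset.sum_congr rfl fun l _ => by ring
  have hlap : ∑ k, ∑ l, a k l p * ∑ i, ∑ j,
      dirDeriv (b k) (dirDeriv (b l) (a i j)) p * dirDeriv (b i) f p * dirDeriv (b j) f p
      = ∑ i, ∑ j, ellOp b a (a i j) p * dirDeriv (b i) f p * dirDeriv (b j) f p := by
    rw [sum_sum_mul_sum_sum_comm]
    refine Finset.sum_congr rfl fun i _ => Finset.sum_congr rfl fun j _ => ?_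
    simp only [ellOp, smul_eq_mul, Finset.sum_mul]
    exact Finset.sum_congr rfl fun k _ => Finset.sum_congr rfl fun l _ => by ring
  have hellP : ellOp b a (gradSq b a f) p = ∑ k, ∑ l,
      a k l p * dirDeriv (b k) (dirDeriv (b l) (gradSq b a f)) p := rfl
  rw [ellOp_harnackQuantity hΩ ha hf hp, dirDeriv_harnackQuantity hΩ ha hf hp,
    ellOp_dirDeriv hΩ ha hf hp τ, hell, hellP]
  simp only [dirDeriv_dirDeriv_gradSq hΩ ha hf hp]
  simp only [Finset.sum_add_distrib (M := ℝ), mul_add] at hcomm hlap ⊢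
  rw [dirDeriv_gradSq hΩ ha hf hp]
  simp only [hT] at hcomm
  unfold evolutionRHS
  simp only [Finset.sum_add_distrib, mul_add, mul_sub, sub_mul, Finset.sum_sub_distrib, mul_neg,
    neg_mul, Finset.sum_neg_distrib, ← mul_assoc] at hcomm hlap ⊢
  linarith [hcomm, hlap]

end LiYauIdentity

/-! ### Algebraic inequalities behind the gradient estimate -/

section Algebra

variable {ι : Type*} [Fintype ι]

-- A positive semidefinite matrix is `BᵀB`. This reduces traces against `A` to sums over the rows of
-- `B`, both for the Hessian term and in the maximum principle.
open scoped MatrixOrder in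
theorem exists_gram_of_nonneg {A : ι → ι → ℝ} (hsymm : ∀ i j, A i j = A j i)
    (hpos : ∀ ξ : ι → ℝ, 0 ≤ ∑ i, ∑ j, A i j * ξ i * ξ j) :
    ∃ B : ι → ι → ℝ, ∀ i j, A i j = ∑ m, B m i * B m j := by
  classical
  have hps : (Matrix.of A).PosSemidef := by
    refine Matrix.PosSemidef.of_dotProduct_mulVec_nonneg ?_ fun ξ => ?_
    · ext i j
      simp [hsymm i j]
    · have := hpos ξ
      simp only [dotProduct, Matrix.mulVec, Matrix.of_apply, Finset.mul_sum, Pi.star_apply,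
        star_trivial]
      refine this.trans_eq (Finset.sum_congr rfl fun i _ => Finset.sum_congr rfl fun j _ => ?_)
      ring
  obtain ⟨B, hB⟩ := CStarAlgebra.nonneg_iff_eq_star_mul_self.mp hps.nonneg
  refine ⟨B, fun i j => ?_⟩
  have := congrFun (congrFun hB i) j
  simpa [Matrix.mul_apply, Matrix.star_apply] using this

theorem sum_gram_mul {A B : ι → ι → ℝ} (hB : ∀ i j, A i j = ∑ m, B m i * B m j)
    (v w : ι → ℝ) :
    ∑ k, ∑ l, A k l * (v k * w l) = ∑ m, (∑ k, B m k * v k) * ∑ l, B m l * w l := by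
  simp only [hB, Finset.sum_mul, Finset.mul_sum]
  calc _ = ∑ k, ∑ m, ∑ l, B m k * B m l * (v k * w l) :=
        Finset.sum_congr rfl fun k _ => Finset.sum_comm
    _ = _ := by
        rw [Finset.sum_comm]
        exact Finset.sum_congr rfl fun m _ => Finset.sum_comm.trans <|
          Finset.sum_congr rfl fun k _ => Finset.sum_congr rfl fun l _ => by ring

/-- Ellipticity is used once in each pair of indices: writing the outer `A` as `BᵀB` makes the sum
`∑ₘ A(Bₘy, Bₘy) ≥ c ∑ₘ |Bₘy|²`, and the last sum is `∑ᵢ A(y·ᵢ, y·ᵢ) ≥ c|y|²`. -/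
theorem sq_mul_sum_sq_le {A : ι → ι → ℝ} {c : ℝ} (hc : 0 ≤ c) (hsymm : ∀ i j, A i j = A j i)
    (hell : ∀ ξ : ι → ℝ, c * ∑ i, ξ i ^ 2 ≤ ∑ i, ∑ j, A i j * ξ i * ξ j) (y : ι → ι → ℝ) :
    c ^ 2 * ∑ k, ∑ i, y k i ^ 2 ≤
      ∑ k, ∑ l, A k l * ∑ i, ∑ j, A i j * y k i * y l j := by
  obtain ⟨B, hB⟩ := exists_gram_of_nonneg hsymm fun ξ =>
    (mul_nonneg hc (Finset.sum_nonneg fun i _ => sq_nonneg _)).trans (hell ξ)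
  have e1 : ∑ k, ∑ l, A k l * ∑ i, ∑ j, A i j * y k i * y l j
      = ∑ m, ∑ i, ∑ j, A i j * (∑ k, B m k * y k i) * (∑ l, B m l * y l j) := by
    rw [sum_sum_mul_sum_sum_comm, Finset.sum_comm (s := (Finset.univ : Finset ι))
      (f := fun m i => ∑ j, A i j * (∑ k, B m k * y k i) * (∑ l, B m l * y l j))]
    refine Finset.sum_congr rfl fun i _ => ?_
    rw [Finset.sum_comm (f := fun m j => A i j * (∑ k, B m k * y k i) * (∑ l, B m l * y l j))]
    refine Finset.sum_congr rfl fun j _ => ?_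
    simp only [mul_assoc (A i j)]
    rw [← Finset.mul_sum, ← sum_gram_mul hB (fun k => y k i) (fun l => y l j)]
    simp only [Finset.mul_sum]
    exact Finset.sum_congr rfl fun k _ => Finset.sum_congr rfl fun l _ => by ring
  have e2 : ∑ i, ∑ k, ∑ l, A k l * y k i * y l i = ∑ m, ∑ i, (∑ k, B m k * y k i) ^ 2 := by
    rw [Finset.sum_comm (f := fun m i => (∑ k, B m k * y k i) ^ 2)]
    refine Finset.sum_congr rfl fun i _ => ?_
    simp only [sq, mul_assoc (A _ _)]
    exact sum_gram_mul hB (fun k => y k i) (fun l => y l i)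
  calc c ^ 2 * ∑ k, ∑ i, y k i ^ 2 = c * ∑ i, c * ∑ k, y k i ^ 2 := by
        rw [Finset.sum_comm, ← Finset.mul_sum]; ring
    _ ≤ c * ∑ i, ∑ k, ∑ l, A k l * y k i * y l i :=
        mul_le_mul_of_nonneg_left (Finset.sum_le_sum fun i _ => hell fun k => y k i) hc
    _ = ∑ m, c * ∑ i, (∑ k, B m k * y k i) ^ 2 := by rw [e2, Finset.mul_sum]
    _ ≤ ∑ m, ∑ i, ∑ j, A i j * (∑ k, B m k * y k i) * (∑ l, B m l * y l j) :=
        Finset.sum_le_sum fun m _ => hell fun i => ∑ k, B m k * y k i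
    _ = _ := e1.symm

theorem abs_sum_sum_le {F : ι → ι → ℝ} {c : ℝ} (h : ∀ i j, |F i j| ≤ c) :
    |∑ i, ∑ j, F i j| ≤ (Fintype.card ι : ℝ) ^ 2 * c := by
  calc |∑ i, ∑ j, F i j| ≤ ∑ _i : ι, ∑ _j : ι, c :=
        (Finset.abs_sum_le_sum_abs _ _).trans (Finset.sum_le_sum fun i _ =>
          (Finset.abs_sum_le_sum_abs _ _).trans (Finset.sum_le_sum fun j _ => h i j))
    _ = _ := by simp; ring

theorem abs_mul_mul_le {x y z a b c : ℝ} (hx : |x| ≤ a) (hy : |y| ≤ b) (hz : |z| ≤ c) :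
    |x * y * z| ≤ a * b * c := by
  rw [abs_mul, abs_mul]
  have := (abs_nonneg x).trans hx
  have := (abs_nonneg y).trans hy
  gcongr

/-- The two Hessian-squared sums agree by symmetry of `A` and give the good term `2c²Y²`. Every
other term is bounded entrywise; the mixed coefficient 6 is 4 from the cross terms of `L|∂f|²` plus
2 from commuting `L` with `Dᵢ`. -/
theorem le_evolutionRHS {A L A' : ι → ι → ℝ} {D : ι → ι → ι → ℝ} {x : ι → ℝ} {y : ι → ι → ℝ}
    {c N X Y : ℝ} (hc : 0 ≤ c) (hsymm : ∀ i j, A i j = A j i)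
    (hell : ∀ ξ : ι → ℝ, c * ∑ i, ξ i ^ 2 ≤ ∑ i, ∑ j, A i j * ξ i * ξ j)
    (hA : ∀ i j, |A i j| ≤ N) (hL : ∀ i j, |L i j| ≤ N) (hD : ∀ k i j, |D k i j| ≤ N)
    (hA' : ∀ i j, |A' i j| ≤ N) (hx : ∀ i, |x i| ≤ X) (hy : ∀ i j, |y i j| ≤ Y)
    (hY : Y ^ 2 = ∑ i, ∑ j, y i j ^ 2) :
    2 * c ^ 2 * Y ^ 2 - 2 * (Fintype.card ι : ℝ) ^ 2 * N * X ^ 2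
        - 6 * (Fintype.card ι : ℝ) ^ 4 * N ^ 2 * X * Y - 2 * (Fintype.card ι : ℝ) ^ 2 * N * Y
      ≤ evolutionRHS A L D A' x y := by
  set m : ℝ := (Fintype.card ι : ℝ) with hm
  have h1 : |∑ i, ∑ j, L i j * x i * x j| ≤ m ^ 2 * (N * X * X) :=
    abs_sum_sum_le fun i j => abs_mul_mul_le (hL i j) (hx i) (hx j)
  have h2 : |∑ k, ∑ l, A k l * ∑ i, ∑ j, (D l i j * y k i * x j + D l i j * x i * y k j
        + D k i j * y l i * x j + D k i j * x i * y l j)| ≤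
      m ^ 2 * (N * (m ^ 2 * (4 * (N * X * Y)))) := by
    refine abs_sum_sum_le fun k l => ?_
    rw [abs_mul]
    refine mul_le_mul (hA k l) (abs_sum_sum_le fun i j => ?_) (abs_nonneg _)
      ((abs_nonneg _).trans (hA k l))
    have b1 := abs_mul_mul_le (hD l i j) (hy k i) (hx j)
    have b2 := abs_mul_mul_le (hD l i j) (hx i) (hy k j)
    have b3 := abs_mul_mul_le (hD k i j) (hy l i) (hx j)
    have b4 := abs_mul_mul_le (hD k i j) (hx i) (hy l j)
    rw [abs_le] at *
    constructor <;> nlinarith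
  have hS : ∀ i, |∑ k, ∑ l, D i k l * y k l| ≤ m ^ 2 * (N * Y) := fun i =>
    abs_sum_sum_le fun k l => by
      rw [abs_mul]
      exact mul_le_mul (hD i k l) (hy k l) (abs_nonneg _) ((abs_nonneg _).trans (hD i k l))
  have h4 : |∑ i, ∑ j, A i j * ((∑ k, ∑ l, D i k l * y k l) * x j
        + x i * ∑ k, ∑ l, D j k l * y k l)| ≤ m ^ 2 * (2 * (N * (m ^ 2 * (N * Y)) * X)) := by
    refine abs_sum_sum_le fun i j => ?_
    have b1 := abs_mul_mul_le (hA i j) (hS i) (hx j)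
    have b2 := abs_mul_mul_le (hA i j) (hx i) (hS j)
    rw [mul_add, ← mul_assoc, ← mul_assoc]
    refine (abs_add_le _ _).trans ?_
    linarith
  have h5 : |∑ i, ∑ j, A' i j * x i * x j| ≤ m ^ 2 * (N * X * X) :=
    abs_sum_sum_le fun i j => abs_mul_mul_le (hA' i j) (hx i) (hx j)
  have h6 : |∑ k, ∑ l, A' k l * y k l| ≤ m ^ 2 * (N * Y) :=
    abs_sum_sum_le fun k l => by
      rw [abs_mul]
      exact mul_le_mul (hA' k l) (hy k l) (abs_nonneg _) ((abs_nonneg _).trans (hA' k l))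
  have h3 : 2 * c ^ 2 * Y ^ 2 ≤
      ∑ k, ∑ l, A k l * ∑ i, ∑ j, (A i j * y l i * y k j + A i j * y k i * y l j) := by
    have q := sq_mul_sum_sq_le hc hsymm hell y
    have q' : ∑ k, ∑ l, A k l * ∑ i, ∑ j, A i j * y l i * y k j
        = ∑ k, ∑ l, A k l * ∑ i, ∑ j, A i j * y k i * y l j := by
      rw [Finset.sum_comm]
      exact Finset.sum_congr rfl fun k _ => Finset.sum_congr rfl fun l _ => by rw [hsymm]
    simp only [Finset.sum_add_distrib, mul_add, q']
    rw [← hY] at q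
    linarith
  rw [abs_le] at h1 h2 h4 h5 h6
  unfold evolutionRHS
  nlinarith [h1.1, h2.1, h4.2, h5.1, h6.1, h3]

theorem exists_harnack_constants {c N : ℝ} (hc : 0 < c) (hN : 0 < N) :
    ∃ C B : ℝ, 0 ≤ C ∧ 0 ≤ B ∧ ∀ X Y P G s : ℝ, 0 < G → 0 < s → c * X ^ 2 ≤ P →
      P + G ≤ N * Y → 2 * c ^ 2 * Y ^ 2 - N * X ^ 2 - N * X * Y - N * Y ≤ G / s →
      s * G ≤ C + B * s := by
  -- `κ` converts `c²Y²` into `κ(P² + G²)` by `P + G ≤ N Y`. `N₂` is the Young remainder when `N X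
  -- Y` and `N Y` each consume `c²Y²/2`; `N₁` makes the resulting `X²` term linear in `P`; `R`
  -- collects the constants after `κP²` absorbs `N₁P`.
  set κ := c ^ 2 / N ^ 2 with hκ
  have hκ0 : 0 < κ := by positivity
  set N₂ := N ^ 2 / (2 * c ^ 2) with hN₂
  set N₁ := (N + N₂) / c with hN₁
  set R := N₁ ^ 2 / (4 * κ) + N₂ with hR
  have hR0 : 0 ≤ R := by positivity
  refine ⟨1 / κ, R / κ + 1, by positivity, by positivity, fun X Y P G s hG hs hX hY hmain => ?_⟩
  have hP : 0 ≤ P := le_trans (by positivity) hX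
  have s1 : N * X * Y ≤ c ^ 2 / 2 * Y ^ 2 + N₂ * X ^ 2 := by
    have : 0 ≤ (c * Y - N / c * X) ^ 2 / 2 := by positivity
    have e : (c * Y - N / c * X) ^ 2 / 2 = c ^ 2 / 2 * Y ^ 2 + N₂ * X ^ 2 - N * X * Y := by
      rw [hN₂]; field_simp; ring
    linarith
  have s2 : N * Y ≤ c ^ 2 / 2 * Y ^ 2 + N₂ := by
    have : 0 ≤ (c * Y - N / c) ^ 2 / 2 := by positivity
    have e : (c * Y - N / c) ^ 2 / 2 = c ^ 2 / 2 * Y ^ 2 + N₂ - N * Y := by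
      rw [hN₂]; field_simp; ring
    linarith
  have s3 : κ * (P ^ 2 + G ^ 2) ≤ c ^ 2 * Y ^ 2 := by
    have h1 : P ^ 2 + G ^ 2 ≤ (N * Y) ^ 2 := by nlinarith [mul_nonneg hP hG.le]
    have h2 : c ^ 2 * Y ^ 2 = κ * (N * Y) ^ 2 := by rw [hκ]; field_simp
    rw [h2]
    exact mul_le_mul_of_nonneg_left h1 hκ0.le
  have s4 : (N + N₂) * X ^ 2 ≤ N₁ * P := by
    have : (N + N₂) * X ^ 2 = N₁ * (c * X ^ 2) := by rw [hN₁]; field_simp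
    rw [this]
    exact mul_le_mul_of_nonneg_left hX (by positivity)
  have s5 : N₁ * P ≤ κ * P ^ 2 + N₁ ^ 2 / (4 * κ) := by
    have : 0 ≤ κ * (P - N₁ / (2 * κ)) ^ 2 := by positivity
    have e : κ * (P - N₁ / (2 * κ)) ^ 2 = κ * P ^ 2 + N₁ ^ 2 / (4 * κ) - N₁ * P := by
      field_simp; ring
    linarith
  have s6 : κ * G ^ 2 - R ≤ G / s := by rw [hR]; linarith
  have s7 : s * (κ * G ^ 2 - R) ≤ G := by
    rw [le_div_iff₀ hs] at s6; linarith
  -- If `s G` exceeds the bound, then `G > B ≥ 1`. Hence `κ s G² > G + κ B s G ≥ G + s R`,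
  -- contradicting `s7`. The summand 1 in `B` is what makes `R ≤ κ B G`.
  by_contra! hcon
  set B := R / κ + 1 with hB
  have hB1 : 1 ≤ B := by rw [hB]; have : 0 ≤ R / κ := by positivity
                         linarith
  have hBR : R ≤ κ * B := by rw [hB]; field_simp; linarith
  have hGB : B < G := by
    have : B * s < s * G := lt_of_le_of_lt (le_add_of_nonneg_left (by positivity)) hcon
    nlinarith
  have hk : 1 + κ * B * s < κ * (s * G) := by
    have := mul_lt_mul_of_pos_left hcon hκ0
    have e : κ * (1 / κ + B * s) = 1 + κ * B * s := by field_simp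
    linarith
  have h8 : G * (1 + κ * B * s) < G * (κ * (s * G)) := mul_lt_mul_of_pos_left hk hG
  have h9 : s * R ≤ G * (κ * B * s) := by
    have : R * 1 ≤ (κ * B) * G := mul_le_mul hBR (hB1.trans hGB.le) zero_le_one (by positivity)
    nlinarith
  nlinarith

end Algebra

/-! ### The maximum principle applied to the Harnack quantity -/

section MaximumPrinciple

variable {E ι : Type*} [NormedAddCommGroup E] [NormedSpace ℝ E] [Fintype ι] {Ω : Set E} {p : E}
  {h : E → ℝ}

theorem hasDerivAt_line {F : Type*} [NormedAddCommGroup F] [NormedSpace ℝ F] {h : E → F} {v : E}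
    {r : ℝ} (hd : DifferentiableAt ℝ h (p + r • v)) :
    HasDerivAt (fun s : ℝ => h (p + s • v)) (dirDeriv v h (p + r • v)) r := by
  have h1 : HasDerivAt (fun s : ℝ => p + s • v) v r := by
    simpa using ((hasDerivAt_id r).smul_const v).const_add p
  exact hd.hasFDerivAt.comp_hasDerivAt r h1

/-- At a local maximum along a line the first derivative vanishes and the second one is not
positive. -/
theorem dirDeriv_of_isLocalMax_line (hΩ : IsOpen Ω) (hh : ContDiffOn ℝ ∞ h Ω) (hp : p ∈ Ω) {v : E}
    (hmax : IsLocalMax (fun s : ℝ => h (p + s • v)) 0) :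
    dirDeriv v h p = 0 ∧ dirDeriv v (dirDeriv v h) p ≤ 0 := by
  have hcont : Continuous fun s : ℝ => p + s • v := by fun_prop
  have hev : ∀ᶠ s : ℝ in nhds 0, p + s • v ∈ Ω :=
    hcont.continuousAt.eventually (hΩ.mem_nhds (by simpa using hp))
  have hd : ∀ᶠ s : ℝ in nhds 0, deriv (fun s : ℝ => h (p + s • v)) s = dirDeriv v h (p + s • v) :=
    hev.mono fun s hs => (hasDerivAt_line (differentiableAt_of_contDiffOn hΩ hh hs)).deriv
  have hd2 : deriv (deriv fun s : ℝ => h (p + s • v)) 0 = dirDeriv v (dirDeriv v h) p := by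
    rw [Filter.EventuallyEq.deriv_eq hd]
    have := (hasDerivAt_line (p := p) (v := v) (r := 0) (differentiableAt_of_contDiffOn hΩ
      (contDiffOn_dirDeriv hΩ hh v) (by simpa using hp))).deriv
    simpa using this
  have h1 : deriv (fun s : ℝ => h (p + s • v)) 0 = 0 := hmax.deriv_eq_zero
  refine ⟨by simpa [hd.self_of_nhds] using h1, ?_⟩
  by_contra! hpos
  rw [← hd2] at hpos
  have hc : ContinuousAt (fun s : ℝ => h (p + s • v)) 0 :=
    (hasDerivAt_line (p := p) (v := v) (r := 0)
      (differentiableAt_of_contDiffOn hΩ hh (by simpa using hp))).continuousAt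
  -- A positive second derivative would make the point a local minimum as well, so the function
  -- would be locally constant and its second derivative zero.
  have hmin := isLocalMin_of_deriv_deriv_pos hpos h1 hc
  have hconst : (fun s : ℝ => h (p + s • v)) =ᶠ[nhds 0] fun _ => h (p + (0 : ℝ) • v) := by
    filter_upwards [hmin, hmax] with s hs hs'
    exact le_antisymm hs' hs
  have : deriv (deriv fun s : ℝ => h (p + s • v)) 0 = 0 := by
    rw [hconst.deriv.deriv_eq]
    simp
  linarith

theorem dirDeriv_sum_smul {F : Type*} [NormedAddCommGroup F] [NormedSpace ℝ F] (h : E → F)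
    (c : ι → ℝ) (b : ι → E) (p : E) :
    dirDeriv (∑ k, c k • b k) h p = ∑ k, c k • dirDeriv (b k) h p := by
  simp [dirDeriv]

/-- With `a = BᵀB`, the operator is a sum of pure second derivatives along the directions `∑ₖ Bₘₖ
bₖ`, each nonpositive at a maximum. Maximality is required only along lines in the span of `b`, so
that it can later be restricted to one time slice. -/
theorem ellOp_nonpos_of_isLocalMax (hΩ : IsOpen Ω) (hh : ContDiffOn ℝ ∞ h Ω) (hp : p ∈ Ω)
    {b : ι → E} {a : ι → ι → E → ℝ} (hsymm : ∀ i j, a i j p = a j i p)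
    (hpos : ∀ ξ : ι → ℝ, 0 ≤ ∑ i, ∑ j, a i j p * ξ i * ξ j)
    (hmax : ∀ c : ι → ℝ, IsLocalMax (fun s : ℝ => h (p + s • ∑ k, c k • b k)) 0) :
    ellOp b a h p ≤ 0 := by
  obtain ⟨B, hB⟩ := exists_gram_of_nonneg hsymm hpos
  have key : ∀ c : ι → ℝ, ∑ k, ∑ l, c k * c l * dirDeriv (b k) (dirDeriv (b l) h) p ≤ 0 := by
    intro c
    have h2 := (dirDeriv_of_isLocalMax_line hΩ hh hp (hmax c)).2
    have hD := fun l => contDiffOn_dirDeriv hΩ hh (b l)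
    rw [dirDeriv_congr hΩ (fun q _ => dirDeriv_sum_smul h c b q) hp, dirDeriv_sum_smul] at h2
    refine le_trans (le_of_eq ?_) h2
    refine Finset.sum_congr rfl fun k _ => ?_
    simp only [smul_eq_mul]
    rw [dirDeriv_sum hΩ (fun l _ => contDiffOn_const.mul (hD l)) hp, Finset.mul_sum]
    refine Finset.sum_congr rfl fun l _ => ?_
    rw [dirDeriv_const_mul hΩ (hD l) hp]
    ring
  have : ellOp b a h p =
      ∑ m, ∑ k, ∑ l, B m k * B m l * dirDeriv (b k) (dirDeriv (b l) h) p := by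
    simp only [ellOp, hB, smul_eq_mul, Finset.sum_mul]
    rw [Finset.sum_comm (f := fun m k => ∑ l, B m k * B m l * _)]
    exact Finset.sum_congr rfl fun k _ => Finset.sum_comm
  rw [this]
  exact Finset.sum_nonpos fun m _ => key (B m)

/-- One-sided in time: comparison with earlier times suffices, so the maximum may sit at the final
time. -/
theorem nonneg_of_hasDerivAt_of_le_left {φ : ℝ → ℝ} {φ' t ε : ℝ} (hφ : HasDerivAt φ φ' t)
    (hε : ε < t) (hle : ∀ r ∈ Set.Icc ε t, φ r ≤ φ t) : 0 ≤ φ' := by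
  have hmax : IsLocalMaxOn φ (Set.Icc ε t) t :=
    Filter.eventually_of_mem self_mem_nhdsWithin hle
  have hmem : ε - t ∈ posTangentConeAt (Set.Icc ε t) t :=
    sub_mem_posTangentConeAt_of_segment_subset (by
      rw [segment_symm, segment_eq_Icc hε.le])
  have := hmax.hasFDerivWithinAt_nonpos hφ.hasFDerivAt.hasFDerivWithinAt hmem
  simp at this
  by_contra! hneg
  nlinarith

variable {b : ι → E} {τ : E} {a : ι → ι → E → ℝ} {f : E → ℝ}

/-- The constants `C`, `B` of `exists_harnack_constants` bound the Harnack quantity at a maximum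
point. -/
theorem harnackQuantity_le_at_max {c N N' C B s : ℝ} (hc : 0 < c) (hN : 0 < N)
    (hN' : N' = 2 * (Fintype.card ι : ℝ) ^ 2 * N + 6 * (Fintype.card ι : ℝ) ^ 4 * N ^ 2 + 1)
    (hCB : ∀ X Y P G s : ℝ, 0 < G → 0 < s → c * X ^ 2 ≤ P → P + G ≤ N' * Y →
      2 * c ^ 2 * Y ^ 2 - N' * X ^ 2 - N' * X * Y - N' * Y ≤ G / s → s * G ≤ C + B * s)
    (hΩ : IsOpen Ω) (ha : ∀ i j, ContDiffOn ℝ ∞ (a i j) Ω) (hf : ContDiffOn ℝ ∞ f Ω) (hp : p ∈ Ω)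
    (heq : ∀ q ∈ Ω, dirDeriv τ f q = ellOp b a f q + gradSq b a f q)
    (hsymm : ∀ i j, a i j p = a j i p)
    (hell : ∀ ξ : ι → ℝ, c * ∑ i, ξ i ^ 2 ≤ ∑ i, ∑ j, a i j p * ξ i * ξ j)
    (hA : ∀ i j, |a i j p| ≤ N) (hL : ∀ i j, |ellOp b a (a i j) p| ≤ N)
    (hD : ∀ k i j, |dirDeriv (b k) (a i j) p| ≤ N) (hA' : ∀ i j, |dirDeriv τ (a i j) p| ≤ N)
    (hs : 0 < s) (hpos : 0 < harnackQuantity b τ a f p)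
    (hmax : ∀ c : ι → ℝ,
      IsLocalMax (fun r : ℝ => harnackQuantity b τ a f (p + r • ∑ k, c k • b k)) 0)
    (htime : 0 ≤ harnackQuantity b τ a f p + s * dirDeriv τ (harnackQuantity b τ a f) p) :
    s * harnackQuantity b τ a f p ≤ C + B * s := by
  classical
  subst hN'
  have hG := contDiffOn_harnackQuantity (b := b) (τ := τ) hΩ ha hf
  have hcrit : ∀ k, dirDeriv (b k) (harnackQuantity b τ a f) p = 0 := fun k => by
    have := (dirDeriv_of_isLocalMax_line hΩ hG hp (hmax (Pi.single k 1))).1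
    simpa [dirDeriv_sum_smul, Pi.single_apply] using this
  have hsec : ellOp b a (harnackQuantity b τ a f) p ≤ 0 :=
    ellOp_nonpos_of_isLocalMax hΩ hG hp hsymm (fun ξ => le_trans
      (mul_nonneg hc.le (Finset.sum_nonneg fun i _ => sq_nonneg _)) (hell ξ)) hmax
  have hev := evolution_harnackQuantity hΩ ha hf hp heq hcrit
  set x : ι → ℝ := fun i => dirDeriv (b i) f p with hx
  set y : ι → ι → ℝ := fun i j => dirDeriv (b i) (dirDeriv (b j) f) p with hy
  have hx0 : 0 ≤ ∑ i, x i ^ 2 := Finset.sum_nonneg fun i _ => sq_nonneg _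
  have hy0 : 0 ≤ ∑ i, ∑ j, y i j ^ 2 :=
    Finset.sum_nonneg fun i _ => Finset.sum_nonneg fun j _ => sq_nonneg _
  set X := √(∑ i, x i ^ 2) with hX
  set Y := √(∑ i, ∑ j, y i j ^ 2) with hY
  have hX2 : X ^ 2 = ∑ i, x i ^ 2 := Real.sq_sqrt hx0
  have hY2 : Y ^ 2 = ∑ i, ∑ j, y i j ^ 2 := Real.sq_sqrt hy0
  have hX0 : 0 ≤ X := Real.sqrt_nonneg _
  have hY0 : 0 ≤ Y := Real.sqrt_nonneg _
  have hxX : ∀ i, |x i| ≤ X := fun i => Real.abs_le_sqrt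
    (Finset.single_le_sum (f := fun i => x i ^ 2) (fun i _ => sq_nonneg _) (Finset.mem_univ i))
  have hyY : ∀ i j, |y i j| ≤ Y := fun i j => Real.abs_le_sqrt
    ((Finset.single_le_sum (f := fun j => y i j ^ 2) (fun j _ => sq_nonneg _)
      (Finset.mem_univ j)).trans
    (Finset.single_le_sum (f := fun i => ∑ j, y i j ^ 2)
      (fun i _ => Finset.sum_nonneg fun j _ => sq_nonneg _) (Finset.mem_univ i)))
  have hRHS := le_evolutionRHS hc.le hsymm hell hA hL hD hA' hxX hyY hY2
  rw [← hev] at hRHS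
  have hm : (0 : ℝ) ≤ (Fintype.card ι : ℝ) := Nat.cast_nonneg _
  set m : ℝ := (Fintype.card ι : ℝ)
  set G := harnackQuantity b τ a f p with hGdef
  have htime' : -dirDeriv τ (harnackQuantity b τ a f) p ≤ G / s := by
    rw [le_div_iff₀ hs]; linarith
  have hp1 : 0 ≤ m ^ 2 * N := by positivity
  have hp2 : 0 ≤ m ^ 4 * N ^ 2 := by positivity
  refine hCB X Y (gradSq b a f p) G s hpos hs (by rw [hX2]; exact hell x) ?_ ?_
  -- The equation turns `|∂f|² + G` into `-2 L f`, which is at most a multiple of the Hessian norm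
  -- `Y`.
  · have e1 : gradSq b a f p + G = -2 * ellOp b a f p := by
      rw [hGdef, harnackQuantity, heq p hp]; ring
    have e2 : |ellOp b a f p| ≤ m ^ 2 * (N * Y) := by
      simp only [ellOp, smul_eq_mul]
      refine abs_sum_sum_le fun k l => ?_
      rw [abs_mul]
      exact mul_le_mul (hA k l) (hyY k l) (abs_nonneg _) hN.le
    rw [e1]
    have := (abs_le.1 e2).1
    nlinarith [mul_nonneg hp2 hY0]
  · have q1 : 0 ≤ m ^ 2 * N * X ^ 2 := by positivity
    have q2 : 0 ≤ m ^ 4 * N ^ 2 * X ^ 2 := by positivity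
    have q3 : 0 ≤ m ^ 2 * N * (X * Y) := by positivity
    have q4 : 0 ≤ m ^ 4 * N ^ 2 * Y := by positivity
    have q5 : 0 ≤ X * Y := by positivity
    have q6 : 0 ≤ X ^ 2 := by positivity
    linarith

end MaximumPrinciple

/-! ### Hermitian forms and their duals -/

section HermitianForms

variable {n : ℕ}

/-- The quadratic form `∑ Γᵢⱼ wᵢ w̄ⱼ` of a Hermitian matrix. -/
def hermForm (Γ : Matrix (Fin n) (Fin n) ℂ) (w : Fin n → ℂ) : ℝ :=
  (∑ i, ∑ j, Γ i j * w i * conj (w j)).re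

/-- The quadratic form `∑ g^{i j̄} ζᵢ ζ̄ⱼ` on covectors, where `g^{i j̄}` is the `(j, i)` entry of
`Γ⁻¹`. -/
def dualForm (Γ : Matrix (Fin n) (Fin n) ℂ) (ζ : Fin n → ℂ) : ℝ :=
  (∑ i, ∑ j, Γ⁻¹ j i * ζ i * conj (ζ j)).re

theorem hermForm_eq_mulVec (Γ : Matrix (Fin n) (Fin n) ℂ) (w : Fin n → ℂ) :
    hermForm Γ w = (∑ i, w i * (Γ.mulVec (star w)) i).re := by
  simp only [hermForm, Matrix.mulVec, dotProduct, Finset.mul_sum, Pi.star_apply]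
  congr 1
  refine Finset.sum_congr rfl fun i _ => Finset.sum_congr rfl fun j _ => ?_
  simp; ring

theorem dualForm_eq_mulVec (Γ : Matrix (Fin n) (Fin n) ℂ) (ζ : Fin n → ℂ) :
    dualForm Γ ζ = (∑ j, conj (ζ j) * (Γ⁻¹.mulVec ζ) j).re := by
  simp only [dualForm, Matrix.mulVec, dotProduct, Finset.mul_sum]
  rw [Finset.sum_comm]
  congr 1
  refine Finset.sum_congr rfl fun i _ => Finset.sum_congr rfl fun j _ => ?_
  ring

theorem isUnit_of_hermForm_pos {Γ : Matrix (Fin n) (Fin n) ℂ}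
    (hpos : ∀ w, w ≠ 0 → 0 < hermForm Γ w) : IsUnit Γ := by
  rw [← Matrix.mulVec_injective_iff_isUnit]
  intro v v' hv
  have h0 : Γ.mulVec (v - v') = 0 := by
    rw [Matrix.mulVec_sub]; exact sub_eq_zero.2 hv
  by_contra hne
  have h1 : star (v - v') ≠ 0 := by
    rw [ne_eq, star_eq_zero, sub_eq_zero]; exact hne
  have := hpos _ h1
  rw [hermForm_eq_mulVec, star_star, h0] at this
  simp at this

theorem hermForm_sub {Γ : Matrix (Fin n) (Fin n) ℂ} (hΓ : Γ.IsHermitian) (w v : Fin n → ℂ) :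
    hermForm Γ (w - v) =
      hermForm Γ w - 2 * (∑ i, w i * (Γ.mulVec (star v)) i).re + hermForm Γ v := by
  have hsw : (∑ i, v i * (Γ.mulVec (star w)) i).re = (∑ i, w i * (Γ.mulVec (star v)) i).re := by
    have : ∑ i, v i * (Γ.mulVec (star w)) i = conj (∑ i, w i * (Γ.mulVec (star v)) i) := by
      simp only [Matrix.mulVec, dotProduct, Finset.mul_sum, Pi.star_apply, map_sum, map_mul]
      rw [Finset.sum_comm]
      refine Finset.sum_congr rfl fun i _ => Finset.sum_congr rfl fun j _ => ?_
      have := hΓ.apply j i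
      rw [← this]
      simp; ring
    rw [this, Complex.conj_re]
  simp only [hermForm_eq_mulVec, star_sub, Matrix.mulVec_sub, Pi.sub_apply, sub_mul, mul_sub,
    Finset.sum_sub_distrib, Complex.sub_re, hsw]
  ring

/-- The dual form is the Legendre transform of the Hermitian form. -/
theorem isGreatest_dualForm {Γ : Matrix (Fin n) (Fin n) ℂ} (hΓ : Γ.IsHermitian)
    (hpos : ∀ w, w ≠ 0 → 0 < hermForm Γ w) (ζ : Fin n → ℂ) :
    IsGreatest (Set.range fun w : Fin n → ℂ => 2 * (∑ i, ζ i * w i).re - hermForm Γ w)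
      (dualForm Γ ζ) := by
  have hu := isUnit_of_hermForm_pos hpos
  have hdet : IsUnit Γ.det := (Matrix.isUnit_iff_isUnit_det Γ).1 hu
  set y := Γ⁻¹.mulVec ζ with hy
  have hΓy : Γ.mulVec y = ζ := by
    rw [hy, Matrix.mulVec_mulVec, Matrix.mul_nonsing_inv _ hdet, Matrix.one_mulVec]
  have h1 : dualForm Γ ζ = (∑ i, ζ i * star y i).re := by
    rw [dualForm_eq_mulVec, ← hy, ← Complex.conj_re]
    congr 1
    rw [map_sum]
    exact Finset.sum_congr rfl fun i _ => by simp
  have h2 : hermForm Γ (star y) = dualForm Γ ζ := by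
    rw [hermForm_eq_mulVec, star_star, hΓy, h1]
    congr 1
    exact Finset.sum_congr rfl fun i _ => mul_comm _ _
  refine ⟨⟨star y, ?_⟩, ?_⟩
  · simp only [h2]
    rw [← h1]; ring
  · rintro _ ⟨w, rfl⟩
    have h3 := hermForm_sub hΓ w (star y)
    rw [star_star, hΓy, h2] at h3
    have h4 : 0 ≤ hermForm Γ (w - star y) := by
      rcases eq_or_ne (w - star y) 0 with h0 | h0
      · rw [h0]; simp [hermForm]
      · exact (hpos _ h0).le
    have h5 : ∑ i, ζ i * w i = ∑ i, w i * ζ i := Finset.sum_congr rfl fun i _ => mul_comm _ _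
    simp only [h5]
    linarith

theorem hermForm_pos_of_le {Γ : Matrix (Fin n) (Fin n) ℂ} {c : ℝ} (hc : 0 < c)
    (hell : ∀ w : Fin n → ℂ, c * ∑ i, ‖w i‖ ^ 2 ≤ hermForm Γ w) (w : Fin n → ℂ) (hw : w ≠ 0) :
    0 < hermForm Γ w := by
  refine lt_of_lt_of_le (mul_pos hc ?_) (hell w)
  obtain ⟨i, hi⟩ := Function.ne_iff.1 hw
  exact Finset.sum_pos' (fun j _ => sq_nonneg _) ⟨i, Finset.mem_univ _, by
    have : 0 < ‖w i‖ := norm_pos_iff.2 hi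
    positivity⟩

/-- The `j`-th column `y` of the inverse solves `Γ y = eⱼ`. Pairing with `y` gives `c|y|² ≤ Re yⱼ ≤
|yⱼ|`, so first `c|yⱼ| ≤ 1` and then `c²|yᵢ|² ≤ c|yⱼ| ≤ 1`. -/
theorem norm_inv_apply_le {Γ : Matrix (Fin n) (Fin n) ℂ} {c : ℝ} (hc : 0 < c)
    (hell : ∀ w : Fin n → ℂ, c * ∑ i, ‖w i‖ ^ 2 ≤ hermForm Γ w)
    (i j : Fin n) : ‖Γ⁻¹ i j‖ ≤ 1 / c := by
  have hu := isUnit_of_hermForm_pos (hermForm_pos_of_le hc hell)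
  have hdet : IsUnit Γ.det := (Matrix.isUnit_iff_isUnit_det Γ).1 hu
  set y : Fin n → ℂ := fun k => Γ⁻¹ k j with hy
  have hΓy : ∀ k, Γ.mulVec y k = (1 : Matrix (Fin n) (Fin n) ℂ) k j := by
    intro k
    rw [← Matrix.mul_nonsing_inv _ hdet, Matrix.mul_apply]; rfl
  have h1 : hermForm Γ (star y) = (y j).re := by
    rw [hermForm_eq_mulVec, star_star]
    simp [hΓy, Matrix.one_apply]
  have h2 := hell (star y)
  rw [h1] at h2
  have h3 : (y j).re ≤ ‖y j‖ := Complex.re_le_norm _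
  simp only [Pi.star_apply, norm_star] at h2
  have h4 : ∀ k, ‖y k‖ ^ 2 ≤ ∑ i, ‖y i‖ ^ 2 := fun k =>
    Finset.single_le_sum (f := fun i => ‖y i‖ ^ 2) (fun i _ => sq_nonneg _) (Finset.mem_univ k)
  set S := ∑ i, ‖y i‖ ^ 2
  have h5 : c * ‖y j‖ ≤ 1 := by
    by_contra! hcon
    have : 0 < ‖y j‖ := by
      by_contra! h0
      have : ‖y j‖ = 0 := le_antisymm h0 (norm_nonneg _)
      rw [this] at hcon; simp at hcon; linarith
    have : c * ‖y j‖ ^ 2 ≤ c * S := mul_le_mul_of_nonneg_left (h4 j) hc.le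
    nlinarith
  have h6 : (c * ‖y i‖) ^ 2 ≤ 1 := by
    have : c * ‖y i‖ ^ 2 ≤ c * S := mul_le_mul_of_nonneg_left (h4 i) hc.le
    nlinarith
  rw [le_div_iff₀ hc, mul_comm]
  have : 0 ≤ c * ‖y i‖ := by positivity
  change c * ‖y i‖ ≤ 1
  nlinarith

/-- Test the Legendre supremum at `w = ζ̄ / c`. -/
theorem le_dualForm {Γ : Matrix (Fin n) (Fin n) ℂ} {c : ℝ} (hc : 0 < c)
    (hΓ : Γ.IsHermitian) (hpos : ∀ w, w ≠ 0 → 0 < hermForm Γ w)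
    (hle : ∀ w : Fin n → ℂ, hermForm Γ w ≤ c * ∑ i, ‖w i‖ ^ 2) (ζ : Fin n → ℂ) :
    1 / c * ∑ i, ‖ζ i‖ ^ 2 ≤ dualForm Γ ζ := by
  have h1 := (isGreatest_dualForm hΓ hpos ζ).2 ⟨fun i => ((1 / c : ℝ) : ℂ) * conj (ζ i), rfl⟩
  have h2 := hle fun i => ((1 / c : ℝ) : ℂ) * conj (ζ i)
  have h3 : ∑ i, ‖((1 / c : ℝ) : ℂ) * conj (ζ i)‖ ^ 2 = (1 / c) ^ 2 * ∑ i, ‖ζ i‖ ^ 2 := by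
    rw [Finset.mul_sum]
    refine Finset.sum_congr rfl fun i _ => ?_
    rw [norm_mul, Complex.norm_real, RCLike.norm_conj, mul_pow, Real.norm_eq_abs, sq_abs]
  have h4 : (∑ i, ζ i * (((1 / c : ℝ) : ℂ) * conj (ζ i))).re = 1 / c * ∑ i, ‖ζ i‖ ^ 2 := by
    rw [Complex.re_sum, Finset.mul_sum]
    refine Finset.sum_congr rfl fun i _ => ?_
    rw [mul_left_comm, Complex.mul_conj, ← Complex.ofReal_mul, Complex.ofReal_re,
      Complex.normSq_eq_norm_sq]
  simp only [h4] at h1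
  rw [h3] at h2
  have h5 : c * ((1 / c) ^ 2 * ∑ i, ‖ζ i‖ ^ 2) = 1 / c * ∑ i, ‖ζ i‖ ^ 2 := by
    field_simp
  linarith

theorem hermForm_le_of_norm_le {Γ : Matrix (Fin n) (Fin n) ℂ} {c : ℝ} (h : ∀ i j, ‖Γ i j‖ ≤ c)
    (w : Fin n → ℂ) : hermForm Γ w ≤ n * c * ∑ i, ‖w i‖ ^ 2 := by
  rcases isEmpty_or_nonempty (Fin n) with hn | ⟨⟨k⟩⟩
  · simp [hermForm]
  have hc : 0 ≤ c := (norm_nonneg _).trans (h k k)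
  calc hermForm Γ w ≤ ‖∑ i, ∑ j, Γ i j * w i * conj (w j)‖ := Complex.re_le_norm _
    _ ≤ ∑ i, ∑ j, c * ‖w i‖ * ‖w j‖ := by
        refine (norm_sum_le _ _).trans (Finset.sum_le_sum fun i _ => (norm_sum_le _ _).trans
          (Finset.sum_le_sum fun j _ => ?_))
        rw [norm_mul, norm_mul, RCLike.norm_conj]
        gcongr
        exact h i j
    _ = c * (∑ i, ‖w i‖) ^ 2 := by
        rw [sq, Finset.sum_mul_sum, Finset.mul_sum]
        refine Finset.sum_congr rfl fun i _ => ?_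
        rw [Finset.mul_sum]
        exact Finset.sum_congr rfl fun j _ => by ring
    _ ≤ c * (n * ∑ i, ‖w i‖ ^ 2) := by
        gcongr
        simpa using sq_sum_le_card_mul_sum_sq (s := (Finset.univ : Finset (Fin n)))
          (f := fun i => ‖w i‖)
    _ = _ := by ring

end HermitianForms

/-! ### From complex to real coefficients -/

section RealCoefficients

variable {n : ℕ}

/-- The real directions `1`, `√-1` in `ℂ`. -/
def unitDir : Fin 2 → ℂ := ![1, Complex.I]

/-- The coefficients, in real coordinates, of the operator `∑ Hⱼᵢ ∂ᵢ ∂_{j̄}`. -/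
def realCoeff (H : Matrix (Fin n) (Fin n) ℂ) (α β : Fin n × Fin 2) : ℝ :=
  (conj (unitDir α.2) * H β.1 α.1 * unitDir β.2).re / 4

/-- The covector on the right is `∂f` when `ξ` holds the real partial derivatives of `f`; thus the
real squared gradient is `|∂f|²`. -/
theorem sum_realCoeff_mul_mul (Γ : Matrix (Fin n) (Fin n) ℂ) (ξ : Fin n × Fin 2 → ℝ) :
    ∑ α, ∑ β, realCoeff Γ⁻¹ α β * ξ α * ξ β =
      dualForm Γ fun i => ((ξ (i, 0) : ℂ) - Complex.I * ξ (i, 1)) / 2 := by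
  simp only [Fintype.sum_prod_type, dualForm, Complex.re_sum, realCoeff, Fin.sum_univ_two,
    ← Finset.sum_add_distrib]
  refine Finset.sum_congr rfl fun i _ => Finset.sum_congr rfl fun j _ => ?_
  simp [unitDir, Complex.div_re, Complex.div_im, Complex.normSq]
  ring

theorem realCoeff_symm {H : Matrix (Fin n) (Fin n) ℂ} (hH : H.IsHermitian)
    (α β : Fin n × Fin 2) : realCoeff H α β = realCoeff H β α := by
  have : conj (unitDir α.2) * H β.1 α.1 * unitDir β.2 =
      conj (conj (unitDir β.2) * H α.1 β.1 * unitDir α.2) := by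
    rw [← hH.apply α.1 β.1]
    simp; ring
  rw [realCoeff, realCoeff, this, Complex.conj_re]

theorem norm_unitDir (s : Fin 2) : ‖unitDir s‖ = 1 := by
  fin_cases s <;> simp [unitDir]

theorem abs_realCoeff_le (H : Matrix (Fin n) (Fin n) ℂ) (α β : Fin n × Fin 2) :
    |realCoeff H α β| ≤ ‖H β.1 α.1‖ := by
  rw [realCoeff, abs_div]
  have h1 := Complex.abs_re_le_norm (conj (unitDir α.2) * H β.1 α.1 * unitDir β.2)
  rw [norm_mul, norm_mul, RCLike.norm_conj, norm_unitDir, norm_unitDir, one_mul, mul_one] at h1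
  have := norm_nonneg (H β.1 α.1)
  rw [show |(4 : ℝ)| = 4 by norm_num, div_le_iff₀ (by norm_num)]
  linarith

theorem le_sum_realCoeff {Γ : Matrix (Fin n) (Fin n) ℂ} {c : ℝ} (hc : 0 < c)
    (hΓ : Γ.IsHermitian) (hpos : ∀ w, w ≠ 0 → 0 < hermForm Γ w)
    (hle : ∀ w : Fin n → ℂ, hermForm Γ w ≤ c * ∑ i, ‖w i‖ ^ 2) (ξ : Fin n × Fin 2 → ℝ) :
    1 / (4 * c) * ∑ α, ξ α ^ 2 ≤ ∑ α, ∑ β, realCoeff Γ⁻¹ α β * ξ α * ξ β := by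
  rw [sum_realCoeff_mul_mul]
  refine le_trans (le_of_eq ?_) (le_dualForm hc hΓ hpos hle _)
  rw [Fintype.sum_prod_type, Finset.mul_sum, Finset.mul_sum]
  refine Finset.sum_congr rfl fun i _ => ?_
  rw [← Complex.normSq_eq_norm_sq, Fin.sum_univ_two]
  simp [Complex.normSq_apply]
  field_simp
  ring

/-- The imaginary part of a Hermitian matrix is antisymmetric and is killed by a symmetric one.
Applied to commuting second derivatives, this makes the complex Laplacian an operator with real
coefficients. -/
theorem sum_mul_of_symm {κ : Type*} [Fintype κ] {M S : κ → κ → ℂ}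
    (hM : ∀ α β, M β α = conj (M α β)) (hS : ∀ α β, S α β = S β α) :
    ∑ α, ∑ β, M α β * S α β = ∑ α, ∑ β, ((M α β).re : ℂ) * S α β := by
  have h1 : ∑ α, ∑ β, M α β * S α β = ∑ α, ∑ β, M β α * S α β := by
    rw [Finset.sum_comm]
    exact Finset.sum_congr rfl fun α _ => Finset.sum_congr rfl fun β _ => by rw [hS]
  have h2 : (∑ α, ∑ β, M α β * S α β) + ∑ α, ∑ β, M β α * S α β =
      2 * ∑ α, ∑ β, ((M α β).re : ℂ) * S α β := by
    simp only [Finset.mul_sum, ← Finset.sum_add_distrib]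
    refine Finset.sum_congr rfl fun α _ => Finset.sum_congr rfl fun β _ => ?_
    rw [← add_mul, hM α β, Complex.add_conj]
    push_cast; ring
  rw [← h1] at h2
  linear_combination h2 / 2

end RealCoefficients

/-! ### Wirtinger derivatives on space-time -/

section SpaceTime

variable {n : ℕ} {Ω : Set (Cn n × ℝ)}

/-- The real coordinate directions of `ℂⁿ` in space-time. -/
def realDir (α : Fin n × Fin 2) : Cn n × ℝ := (EuclideanSpace.single α.1 (unitDir α.2), 0)

/-- The time direction in space-time. -/
def timeDir : Cn n × ℝ := (0, 1)

/-- The derivative `∂/∂zᵢ` of a function on space-time. -/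
def stDz (i : Fin n) (h : Cn n × ℝ → ℂ) (p : Cn n × ℝ) : ℂ :=
  (dirDeriv (realDir (i, 0)) h p - Complex.I * dirDeriv (realDir (i, 1)) h p) / 2

/-- The derivative `∂/∂z̄ᵢ` of a function on space-time. -/
def stDzbar (i : Fin n) (h : Cn n × ℝ → ℂ) (p : Cn n × ℝ) : ℂ :=
  (dirDeriv (realDir (i, 0)) h p + Complex.I * dirDeriv (realDir (i, 1)) h p) / 2

theorem fderiv_slice {F : Type*} [NormedAddCommGroup F] [NormedSpace ℝ F] {h : Cn n × ℝ → F}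
    {z : Cn n} {t : ℝ} (hd : DifferentiableAt ℝ h (z, t)) (v : Cn n) :
    fderiv ℝ (fun w => h (w, t)) z v = dirDeriv (v, 0) h (z, t) := by
  have := hd.hasFDerivAt.comp z (hasFDerivAt_prodMk_left (𝕜 := ℝ) z t)
  have := this.fderiv
  simp only [Function.comp_def] at this
  rw [this]
  simp [dirDeriv]

theorem dz_slice {h : Cn n × ℝ → ℂ} {z : Cn n} {t : ℝ} (hd : DifferentiableAt ℝ h (z, t))
    (i : Fin n) : dz i (fun w => h (w, t)) z = stDz i h (z, t) := by
  simp only [dz, fderiv_slice hd]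
  rfl

theorem dzbar_slice {h : Cn n × ℝ → ℂ} {z : Cn n} {t : ℝ} (hd : DifferentiableAt ℝ h (z, t))
    (i : Fin n) : dzbar i (fun w => h (w, t)) z = stDzbar i h (z, t) := by
  simp only [dzbar, fderiv_slice hd]
  rfl

theorem contDiffOn_stDzbar {h : Cn n × ℝ → ℂ} (hΩ : IsOpen Ω) (hh : ContDiffOn ℝ ∞ h Ω)
    (i : Fin n) : ContDiffOn ℝ ∞ (stDzbar i h) Ω :=
  ((contDiffOn_dirDeriv hΩ hh _).add (contDiffOn_const.mul (contDiffOn_dirDeriv hΩ hh _))).div_const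
    _

theorem dz_congr_of_eventuallyEq {f h : Cn n → ℂ} {z : Cn n} (hfh : f =ᶠ[nhds z] h) (i : Fin n) :
    dz i f z = dz i h z := by
  simp only [dz, hfh.fderiv_eq]

theorem dz_dzbar_slice {h : Cn n × ℝ → ℂ} {z : Cn n} {t : ℝ} (hΩ : IsOpen Ω)
    (hh : ContDiffOn ℝ ∞ h Ω) (hp : (z, t) ∈ Ω) (i j : Fin n) :
    dz i (dzbar j fun w => h (w, t)) z = stDz i (stDzbar j h) (z, t) := by
  have hev : ∀ᶠ w in nhds z, (w, t) ∈ Ω :=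
    (Continuous.prodMk_left t).continuousAt.eventually (hΩ.mem_nhds hp)
  have : (dzbar j fun w => h (w, t)) =ᶠ[nhds z] fun w => stDzbar j h (w, t) :=
    hev.mono fun w hw => dzbar_slice (differentiableAt_of_contDiffOn hΩ hh hw) j
  rw [dz_congr_of_eventuallyEq this, dz_slice
    (differentiableAt_of_contDiffOn hΩ (contDiffOn_stDzbar hΩ hh j) hp)]

theorem stDz_stDzbar {h : Cn n × ℝ → ℂ} {p : Cn n × ℝ} (hΩ : IsOpen Ω)
    (hh : ContDiffOn ℝ ∞ h Ω) (hp : p ∈ Ω) (i j : Fin n) :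
    stDz i (stDzbar j h) p = ∑ s, ∑ r, conj (unitDir s) * unitDir r / 4
      * dirDeriv (realDir (i, s)) (dirDeriv (realDir (j, r)) h) p := by
  have hD := fun α => contDiffOn_dirDeriv hΩ hh (realDir α)
  have hdir : ∀ v, dirDeriv v (stDzbar j h) p = (dirDeriv v (dirDeriv (realDir (j, 0)) h) p
      + Complex.I * dirDeriv v (dirDeriv (realDir (j, 1)) h) p) / 2 := by
    intro v
    have hI : ContDiffOn ℝ ∞ (fun q => Complex.I * dirDeriv (realDir (j, 1)) h q) Ω :=
      contDiffOn_const.mul (hD (j, 1))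
    have e1 := dirDeriv_const_mul (c := (2⁻¹ : ℂ)) hΩ ((hD (j, 0)).add hI) hp v
    rw [dirDeriv_add hΩ (hD (j, 0)) hI hp, dirDeriv_const_mul hΩ (hD (j, 1)) hp] at e1
    rw [div_eq_inv_mul, ← e1]
    exact dirDeriv_congr hΩ (fun q _ => div_eq_inv_mul _ _) hp v
  simp only [stDz, hdir, Fin.sum_univ_two, unitDir]
  simp
  ring_nf
  simp
  ring

theorem sum_stDz_stDzbar {h : Cn n × ℝ → ℂ} {p : Cn n × ℝ} (hΩ : IsOpen Ω)
    (hh : ContDiffOn ℝ ∞ h Ω) (hp : p ∈ Ω) {H : Matrix (Fin n) (Fin n) ℂ} (hH : H.IsHermitian)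
    {a : Fin n × Fin 2 → Fin n × Fin 2 → Cn n × ℝ → ℝ}
    (ha : ∀ α β, a α β p = realCoeff H α β) :
    ∑ i, ∑ j, H j i * stDz i (stDzbar j h) p = ellOp realDir a h p := by
  set M : Fin n × Fin 2 → Fin n × Fin 2 → ℂ := fun α β =>
    conj (unitDir α.2) * H β.1 α.1 * unitDir β.2 / 4 with hMdef
  have hM : ∀ α β, M β α = conj (M α β) := by
    intro α β
    simp only [hMdef]
    rw [← hH.apply β.1 α.1]
    simp [Complex.conj_ofNat]; ring
  have := sum_mul_of_symm hM fun α β => dirDeriv_comm hΩ hh hp (realDir α) (realDir β)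
  have hre : ∀ α β, (M α β).re = realCoeff H α β := by
    intro α β
    simp only [hMdef, realCoeff]
    rw [show (4 : ℂ) = ((4 : ℝ) : ℂ) by norm_num, Complex.div_ofReal_re]
  simp only [ellOp, ha, Complex.real_smul, ← hre]
  rw [← this]
  simp only [stDz_stDzbar hΩ hh hp, Fintype.sum_prod_type, Finset.mul_sum]
  refine Finset.sum_congr rfl fun i _ => ?_
  rw [Finset.sum_comm]
  refine Finset.sum_congr rfl fun s _ => ?_
  refine Finset.sum_congr rfl fun j _ => Finset.sum_congr rfl fun r _ => ?_
  simp only [hMdef]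
  ring

end SpaceTime

/-! ### Derivatives of the inverse of a matrix function -/

section InverseDerivative

variable {E ι R : Type*} [NormedAddCommGroup E] [NormedSpace ℝ E] [Fintype ι] {Ω : Set E} {p : E}
  [NormedRing R] [NormedAlgebra ℝ R] [CompleteSpace R] {Γ : E → R}

theorem contDiffOn_ringInverse (hΓ : ContDiffOn ℝ ∞ Γ Ω) (hu : ∀ q ∈ Ω, IsUnit (Γ q)) :
    ContDiffOn ℝ ∞ (fun q => Ring.inverse (Γ q)) Ω := by
  intro q hq
  obtain ⟨x, hx⟩ := hu q hq
  have := contDiffAt_ringInverse ℝ (n := ∞) x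
  rw [hx] at this
  exact this.comp_contDiffWithinAt q (hΓ q hq)

theorem dirDeriv_ringInverse (hΩ : IsOpen Ω) (hΓ : ContDiffOn ℝ ∞ Γ Ω)
    (hu : ∀ q ∈ Ω, IsUnit (Γ q)) (hp : p ∈ Ω) (v : E) :
    dirDeriv v (fun q => Ring.inverse (Γ q)) p =
      -(Ring.inverse (Γ p) * dirDeriv v Γ p * Ring.inverse (Γ p)) := by
  obtain ⟨x, hx⟩ := hu p hp
  have h1 := hasFDerivAt_ringInverse (𝕜 := ℝ) x
  have h2 : (↑x⁻¹ : R) = Ring.inverse (Γ p) := by rw [← hx, Ring.inverse_unit]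
  rw [hx, h2] at h1
  have h3 := (h1.comp p (differentiableAt_of_contDiffOn hΩ hΓ hp).hasFDerivAt).fderiv
  simp only [Function.comp_def] at h3
  simp [dirDeriv, h3]

/-- Differentiate `D(Γ⁻¹) = -Γ⁻¹ DΓ Γ⁻¹` once more. After contraction with `a`, second derivatives
of `Γ` survive only as `ellOp b a Γ`, hence only mixed complex derivatives of the metric are needed.
-/
theorem ellOp_ringInverse (hΩ : IsOpen Ω) (hΓ : ContDiffOn ℝ ∞ Γ Ω)
    (hu : ∀ q ∈ Ω, IsUnit (Γ q)) (hp : p ∈ Ω) (b : ι → E) (a : ι → ι → E → ℝ) :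
    ellOp b a (fun q => Ring.inverse (Γ q)) p =
      (∑ k, ∑ l, a k l p • (Ring.inverse (Γ p) * dirDeriv (b k) Γ p * Ring.inverse (Γ p)
          * dirDeriv (b l) Γ p * Ring.inverse (Γ p)
        + Ring.inverse (Γ p) * dirDeriv (b l) Γ p * Ring.inverse (Γ p)
          * dirDeriv (b k) Γ p * Ring.inverse (Γ p)))
      - Ring.inverse (Γ p) * ellOp b a Γ p * Ring.inverse (Γ p) := by
  have hH := contDiffOn_ringInverse hΓ hu
  have hD := fun v => contDiffOn_dirDeriv hΩ hΓ v
  have key : ∀ v w, dirDeriv v (dirDeriv w fun q => Ring.inverse (Γ q)) p =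
      (Ring.inverse (Γ p) * dirDeriv v Γ p * Ring.inverse (Γ p)
          * dirDeriv w Γ p * Ring.inverse (Γ p)
        + Ring.inverse (Γ p) * dirDeriv w Γ p * Ring.inverse (Γ p)
          * dirDeriv v Γ p * Ring.inverse (Γ p))
      - Ring.inverse (Γ p) * dirDeriv v (dirDeriv w Γ) p * Ring.inverse (Γ p) := by
    intro v w
    rw [dirDeriv_congr hΩ (fun q hq => dirDeriv_ringInverse hΩ hΓ hu hq w) hp]
    have e0 := dirDeriv_clm (-(ContinuousLinearMap.id ℝ R)) hΩ ((hH.mul (hD w)).mul hH) hp v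
    have e1 := dirDeriv_mul hΩ (hH.mul (hD w)) hH hp v
    have e2 := dirDeriv_mul hΩ hH (hD w) hp v
    have e3 := dirDeriv_ringInverse hΩ hΓ hu hp v
    simp only [neg_apply, ContinuousLinearMap.id_apply] at e0
    rw [e0, e1, e2, e3]
    noncomm_ring
  simp only [ellOp, key, smul_sub, Finset.sum_sub_distrib, Finset.mul_sum, Finset.sum_mul,
    mul_smul_comm, smul_mul_assoc]

theorem norm_dirDeriv_ringInverse_le (hΩ : IsOpen Ω) (hΓ : ContDiffOn ℝ ∞ Γ Ω)
    (hu : ∀ q ∈ Ω, IsUnit (Γ q)) (hp : p ∈ Ω) {v : E} {η N : ℝ} (hη : ‖Ring.inverse (Γ p)‖ ≤ η)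
    (hN : ‖dirDeriv v Γ p‖ ≤ N) :
    ‖dirDeriv v (fun q => Ring.inverse (Γ q)) p‖ ≤ η * N * η := by
  rw [dirDeriv_ringInverse hΩ hΓ hu hp, norm_neg]
  have := (norm_nonneg _).trans hη
  have := (norm_nonneg _).trans hN
  exact (norm_mul_le _ _).trans (mul_le_mul ((norm_mul_le _ _).trans (mul_le_mul hη hN
    (norm_nonneg _) (by positivity))) hη (norm_nonneg _) (by positivity))

theorem norm_ellOp_ringInverse_le (hΩ : IsOpen Ω) (hΓ : ContDiffOn ℝ ∞ Γ Ω)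
    (hu : ∀ q ∈ Ω, IsUnit (Γ q)) (hp : p ∈ Ω) {b : ι → E} {a : ι → ι → E → ℝ} {η N A L : ℝ}
    (hη : ‖Ring.inverse (Γ p)‖ ≤ η) (hN : ∀ k, ‖dirDeriv (b k) Γ p‖ ≤ N)
    (hA : ∀ k l, |a k l p| ≤ A) (hL : ‖ellOp b a Γ p‖ ≤ L) :
    ‖ellOp b a (fun q => Ring.inverse (Γ q)) p‖ ≤
      (Fintype.card ι : ℝ) ^ 2 * (A * (2 * (η * N * η * N * η))) + η * L * η := by
  have hη0 := (norm_nonneg _).trans hη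
  have hL0 := (norm_nonneg _).trans hL
  have h3 : ∀ {x y z : R} {r s t : ℝ}, ‖x‖ ≤ r → ‖y‖ ≤ s → ‖z‖ ≤ t → ‖x * y * z‖ ≤ r * s * t :=
    fun hx hy hz => (norm_mul_le _ _).trans (mul_le_mul ((norm_mul_le _ _).trans (mul_le_mul hx hy
      (norm_nonneg _) ((norm_nonneg _).trans hx))) hz (norm_nonneg _)
      (mul_nonneg ((norm_nonneg _).trans hx) ((norm_nonneg _).trans hy)))
  rw [ellOp_ringInverse hΩ hΓ hu hp]
  refine (norm_sub_le _ _).trans (add_le_add ?_ (h3 hη hL hη))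
  calc _ ≤ ∑ _k : ι, ∑ _l : ι, A * (2 * (η * N * η * N * η)) := by
        refine (norm_sum_le _ _).trans (Finset.sum_le_sum fun k _ => (norm_sum_le _ _).trans
          (Finset.sum_le_sum fun l _ => ?_))
        rw [norm_smul, Real.norm_eq_abs]
        refine mul_le_mul (hA k l) ?_ (norm_nonneg _) ((abs_nonneg _).trans (hA k l))
        refine (norm_add_le _ _).trans ?_
        have := h3 (h3 hη (hN k) hη) (hN l) hη
        have := h3 (h3 hη (hN l) hη) (hN k) hη
        linarith
    _ = _ := by simp; ring

end InverseDerivative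

theorem ellOp_clm {E ι F G : Type*} [NormedAddCommGroup E] [NormedSpace ℝ E] [Fintype ι]
    [NormedAddCommGroup F] [NormedSpace ℝ F] [NormedAddCommGroup G] [NormedSpace ℝ G]
    {Ω : Set E} {p : E} {h : E → F} (L : F →L[ℝ] G) (hΩ : IsOpen Ω) (hh : ContDiffOn ℝ ∞ h Ω)
    (hp : p ∈ Ω) (b : ι → E) (a : ι → ι → E → ℝ) :
    ellOp b a (fun q => L (h q)) p = L (ellOp b a h p) := by
  simp only [ellOp, map_sum, map_smul]
  refine Finset.sum_congr rfl fun k _ => Finset.sum_congr rfl fun l _ => ?_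
  rw [dirDeriv_congr hΩ (fun q hq => dirDeriv_clm L hΩ hh hq (b l)) hp,
    dirDeriv_clm L hΩ (contDiffOn_dirDeriv hΩ hh (b l)) hp]

/-! ### Bounds for the real coefficients -/

section CoefficientBounds

open scoped Matrix.Norms.Operator

variable {n : ℕ}

theorem norm_apply_le_linftyOp (M : Matrix (Fin n) (Fin n) ℂ) (i j : Fin n) : ‖M i j‖ ≤ ‖M‖ := by
  rw [Matrix.linfty_opNorm_def, ← coe_nnnorm, NNReal.coe_le_coe]
  exact (Finset.single_le_sum (f := fun j => ‖M i j‖₊) (fun _ _ => zero_le)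
    (Finset.mem_univ j)).trans (Finset.le_sup (f := fun i => ∑ j, ‖M i j‖₊) (Finset.mem_univ i))

theorem linftyOp_norm_le {M : Matrix (Fin n) (Fin n) ℂ} {c : ℝ} (hc : 0 ≤ c)
    (h : ∀ i j, ‖M i j‖ ≤ c) : ‖M‖ ≤ n * c := by
  lift c to NNReal using hc
  rw [Matrix.linfty_opNorm_def]
  have : (n : ℝ) * (c : ℝ) = ((n * c : NNReal) : ℝ) := by push_cast; rfl
  rw [this, NNReal.coe_le_coe]
  refine Finset.sup_le fun i _ => ?_
  calc ∑ j, ‖M i j‖₊ ≤ ∑ _j : Fin n, c := Finset.sum_le_sum fun j _ => h i j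
    _ = n * c := by simp

/-- The `(i, j)` entry of a matrix, as a continuous linear map. -/
def entryCLM (i j : Fin n) : Matrix (Fin n) (Fin n) ℂ →L[ℝ] ℂ :=
  LinearMap.toContinuousLinearMap (Matrix.entryLinearMap ℝ ℂ i j)

/-- `realCoeff`, as a continuous linear map. -/
def realCoeffCLM (α β : Fin n × Fin 2) : Matrix (Fin n) (Fin n) ℂ →L[ℝ] ℝ :=
  LinearMap.toContinuousLinearMap
    { toFun := fun M => realCoeff M α β
      map_add' := fun M M' => by simp [realCoeff, mul_add, add_mul]; ring
      map_smul' := fun r M => by simp [realCoeff]; ring }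

variable {E : Type*} [NormedAddCommGroup E] [NormedSpace ℝ E] {Ω : Set E}
  {Γ : E → Matrix (Fin n) (Fin n) ℂ}

theorem contDiffOn_matrix (hΓ : ∀ i j, ContDiffOn ℝ ∞ (fun q => Γ q i j) Ω) :
    ContDiffOn ℝ ∞ Γ Ω := by
  have : Γ = fun q => ∑ i, ∑ j, (LinearMap.toContinuousLinearMap
      (Matrix.singleLinearMap ℝ i j : ℂ →ₗ[ℝ] Matrix (Fin n) (Fin n) ℂ)) (Γ q i j) := by
    funext q
    simpa using Matrix.matrix_eq_sum_single (Γ q)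
  rw [this]
  exact ContDiffOn.sum fun i _ => ContDiffOn.sum fun j _ =>
    (ContinuousLinearMap.contDiff _).comp_contDiffOn (hΓ i j)

theorem contDiffOn_realCoeff_inv (hΓ : ∀ i j, ContDiffOn ℝ ∞ (fun q => Γ q i j) Ω)
    (hu : ∀ q ∈ Ω, IsUnit (Γ q)) (α β : Fin n × Fin 2) :
    ContDiffOn ℝ ∞ (fun q => realCoeff (Γ q)⁻¹ α β) Ω := by
  simp only [Matrix.nonsing_inv_eq_ringInverse]
  exact (realCoeffCLM α β).contDiff.comp_contDiffOn
    (contDiffOn_ringInverse (contDiffOn_matrix hΓ) hu)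

/-- Hermitian symmetry gives `∂_{k̄} Γᵢⱼ = conj (∂ₖ Γⱼᵢ)`, so the bound on `∂ₖ` alone controls both
Wirtinger derivatives, and `∂ₓ = ∂ + ∂̄`, `∂ᵧ = √-1 (∂ - ∂̄)`. -/
theorem norm_dirDeriv_realDir_le {Ω : Set (Cn n × ℝ)} {p : Cn n × ℝ}
    {Γ : Cn n × ℝ → Matrix (Fin n) (Fin n) ℂ} {K : ℝ} (hΩ : IsOpen Ω)
    (hΓ : ∀ i j, ContDiffOn ℝ ∞ (fun q => Γ q i j) Ω) (hherm : ∀ q ∈ Ω, (Γ q).IsHermitian)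
    (hp : p ∈ Ω) (hK : ∀ i j k, ‖stDz k (fun q => Γ q i j) p‖ ≤ K) (i j : Fin n)
    (α : Fin n × Fin 2) : ‖dirDeriv (realDir α) (fun q => Γ q i j) p‖ ≤ 2 * K := by
  obtain ⟨k, s⟩ := α
  have hconj : ∀ v, dirDeriv v (fun q => Γ q i j) p = conj (dirDeriv v (fun q => Γ q j i) p) := by
    intro v
    have := dirDeriv_clm (Complex.conjCLE : ℂ →L[ℝ] ℂ) hΩ (hΓ j i) hp v
    rw [← show (Complex.conjCLE : ℂ →L[ℝ] ℂ) (dirDeriv v (fun q => Γ q j i) p) =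
      conj (dirDeriv v (fun q => Γ q j i) p) from rfl, ← this]
    exact dirDeriv_congr hΩ (fun q hq => ((hherm q hq).apply i j).symm) hp v
  have h1 := hK i j k
  have h2 := hK j i k
  have h3 : stDzbar k (fun q => Γ q i j) p = conj (stDz k (fun q => Γ q j i) p) := by
    simp only [stDz, stDzbar, hconj]
    simp [Complex.conj_ofNat]
  have h4 : ‖stDzbar k (fun q => Γ q i j) p‖ ≤ K := by rw [h3, RCLike.norm_conj]; exact h2
  fin_cases s
  · have : dirDeriv (realDir (k, 0)) (fun q => Γ q i j) p =
        stDz k (fun q => Γ q i j) p + stDzbar k (fun q => Γ q i j) p := by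
      simp only [stDz, stDzbar]; ring
    change ‖dirDeriv (realDir (k, 0)) (fun q => Γ q i j) p‖ ≤ _
    rw [this]
    exact (norm_add_le _ _).trans (by linarith)
  · have : dirDeriv (realDir (k, 1)) (fun q => Γ q i j) p =
        Complex.I * (stDz k (fun q => Γ q i j) p - stDzbar k (fun q => Γ q i j) p) := by
      simp only [stDz, stDzbar]
      linear_combination (dirDeriv (realDir (k, 1)) (fun q => Γ q i j) p) * Complex.I_sq
    change ‖dirDeriv (realDir (k, 1)) (fun q => Γ q i j) p‖ ≤ _
    rw [this, norm_mul, Complex.norm_I, one_mul]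
    exact (norm_sub_le _ _).trans (by linarith)

/-- Bounds for the coefficients of the operator `g^{i j̄} ∂ᵢ ∂_{j̄}` in real coordinates in terms of
bounds for the matrix `g_{i j̄}`. -/
theorem exists_coefficient_bound (n : ℕ) {c₀ c₁ K : ℝ} (hc₀ : 0 < c₀) (hc₁ : 0 < c₁) (hK : 0 ≤ K) :
    ∃ c N : ℝ, 0 < c ∧ 0 < N ∧ ∀ (Ω : Set (Cn n × ℝ)) (p : Cn n × ℝ)
      (Γ : Cn n × ℝ → Matrix (Fin n) (Fin n) ℂ), IsOpen Ω →
      (∀ i j, ContDiffOn ℝ ∞ (fun q => Γ q i j) Ω) → (∀ q ∈ Ω, (Γ q).IsHermitian) →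
      (∀ q ∈ Ω, ∀ w, w ≠ 0 → 0 < hermForm (Γ q) w) → p ∈ Ω →
      (∀ w : Fin n → ℂ, c₀ * ∑ i, ‖w i‖ ^ 2 ≤ hermForm (Γ p) w) →
      (∀ w : Fin n → ℂ, hermForm (Γ p) w ≤ c₁ * ∑ i, ‖w i‖ ^ 2) →
      (∀ i j k, ‖stDz k (fun q => Γ q i j) p‖ ≤ K) →
      (∀ i j k l, ‖stDz k (stDzbar l fun q => Γ q i j) p‖ ≤ K) →
      (∀ i j, ‖dirDeriv timeDir (fun q => Γ q i j) p‖ ≤ K) →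
      (∀ ξ : Fin n × Fin 2 → ℝ, c * ∑ α, ξ α ^ 2 ≤
        ∑ α, ∑ β, realCoeff (Γ p)⁻¹ α β * ξ α * ξ β) ∧
      (∀ α β, |realCoeff (Γ p)⁻¹ α β| ≤ N) ∧
      (∀ α β, |ellOp realDir (fun α β q => realCoeff (Γ q)⁻¹ α β)
        (fun q => realCoeff (Γ q)⁻¹ α β) p| ≤ N) ∧
      (∀ γ α β, |dirDeriv (realDir γ) (fun q => realCoeff (Γ q)⁻¹ α β) p| ≤ N) ∧
      (∀ α β, |dirDeriv timeDir (fun q => realCoeff (Γ q)⁻¹ α β) p| ≤ N) := by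
  -- In the row-sum norm, `η` bounds `Γ⁻¹`, `D` its first derivatives' input `DΓ`, `L` the
  -- contraction `g^{k l̄} ∂ₖ ∂_{l̄} Γ`, and `S` the operator applied to `Γ⁻¹`.
  set η : ℝ := n * (1 / c₀) with hη
  set D : ℝ := n * (2 * K) with hD
  set L : ℝ := n * (n ^ 2 * (1 / c₀ * K)) with hL
  set S : ℝ := (Fintype.card (Fin n × Fin 2) : ℝ) ^ 2 * (1 / c₀ * (2 * (η * D * η * D * η)))
    + η * L * η with hS
  have hη0 : 0 ≤ η := by positivity
  have hD0 : 0 ≤ D := by positivity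
  have hL0 : 0 ≤ L := by positivity
  have hS0 : 0 ≤ S := by positivity
  have hDD0 : 0 ≤ η * D * η := by positivity
  have hc00 : 0 < 1 / c₀ := by positivity
  -- The 4 comes from `|∂f|² = |Df|²/4` in Euclidean norms.
  refine ⟨1 / (4 * c₁), 1 / c₀ + S + η * D * η, by positivity, by positivity, ?_⟩
  intro Ω p Γ hΩ hΓ hherm hpos hp hlow hup hz hzz ht
  have hu : ∀ q ∈ Ω, IsUnit (Γ q) := fun q hq => isUnit_of_hermForm_pos (hpos q hq)
  have hM := contDiffOn_matrix hΓ
  have hinv : ∀ i j, ‖(Γ p)⁻¹ i j‖ ≤ 1 / c₀ := norm_inv_apply_le hc₀ hlow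
  have hA : ∀ α β, |realCoeff (Γ p)⁻¹ α β| ≤ 1 / c₀ := fun α β =>
    (abs_realCoeff_le _ α β).trans (hinv _ _)
  have hH : ‖Ring.inverse (Γ p)‖ ≤ η := by
    rw [← Matrix.nonsing_inv_eq_ringInverse]
    exact linftyOp_norm_le hc00.le hinv
  have hentry : ∀ v i j, dirDeriv v Γ p i j = dirDeriv v (fun q => Γ q i j) p := fun v i j =>
    (dirDeriv_clm (entryCLM i j) hΩ hM hp v).symm
  have hDs : ∀ α, ‖dirDeriv (realDir α) Γ p‖ ≤ D := fun α =>
    linftyOp_norm_le (by positivity) fun i j => by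
      rw [hentry]; exact norm_dirDeriv_realDir_le hΩ hΓ hherm hp hz i j α
  have hDt : ‖dirDeriv timeDir Γ p‖ ≤ D :=
    linftyOp_norm_le (by positivity) fun i j => by
      rw [hentry]; exact (ht i j).trans (by linarith)
  have hell : ‖ellOp realDir (fun α β q => realCoeff (Γ q)⁻¹ α β) Γ p‖ ≤ L := by
    refine linftyOp_norm_le (by positivity) fun i j => ?_
    have e : ellOp realDir (fun α β q => realCoeff (Γ q)⁻¹ α β) (fun q => Γ q i j) p =
        (show Matrix (Fin n) (Fin n) ℂ from
          ellOp realDir (fun α β q => realCoeff (Γ q)⁻¹ α β) Γ p) i j :=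
      ellOp_clm (entryCLM i j) hΩ hM hp realDir (fun α β q => realCoeff (Γ q)⁻¹ α β)
    refine (congrArg norm e).symm.le.trans ?_
    rw [← sum_stDz_stDzbar hΩ (hΓ i j) hp (hherm p hp).inv fun _ _ => rfl]
    calc _ ≤ ∑ _i : Fin n, ∑ _j : Fin n, 1 / c₀ * K := by
          refine (norm_sum_le _ _).trans (Finset.sum_le_sum fun k _ => (norm_sum_le _ _).trans
            (Finset.sum_le_sum fun l _ => ?_))
          rw [norm_mul]
          exact mul_le_mul (hinv l k) (hzz i j k l) (norm_nonneg _) hc00.le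
      _ = _ := by simp; ring
  have hcoef : ∀ v α β, |dirDeriv v (fun q => realCoeff (Γ q)⁻¹ α β) p| ≤
      ‖dirDeriv v (fun q => Ring.inverse (Γ q)) p‖ := by
    intro v α β
    have e : dirDeriv v (fun q => realCoeff (Ring.inverse (Γ q)) α β) p =
        realCoeff (dirDeriv v (fun q => Ring.inverse (Γ q)) p) α β :=
      dirDeriv_clm (realCoeffCLM α β) hΩ (contDiffOn_ringInverse hM hu) hp v
    simp only [Matrix.nonsing_inv_eq_ringInverse]
    rw [e]
    exact (abs_realCoeff_le _ α β).trans (norm_apply_le_linftyOp _ _ _)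
  refine ⟨le_sum_realCoeff hc₁ (hherm p hp) (hpos p hp) hup,
    fun α β => (hA α β).trans (by linarith), fun α β => ?_, fun γ α β => ?_, fun α β => ?_⟩
  · have e : ellOp realDir (fun α β q => realCoeff (Γ q)⁻¹ α β)
        (fun q => realCoeff (Ring.inverse (Γ q)) α β) p =
        realCoeff (ellOp realDir (fun α β q => realCoeff (Γ q)⁻¹ α β)
          (fun q => Ring.inverse (Γ q)) p) α β :=
      ellOp_clm (realCoeffCLM α β) hΩ (contDiffOn_ringInverse hM hu) hp realDir
        (fun α β q => realCoeff (Γ q)⁻¹ α β)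
    have h1 := norm_ellOp_ringInverse_le hΩ hM hu hp hH hDs hA hell
    have h2 := (abs_realCoeff_le (ellOp realDir (fun α β q => realCoeff (Γ q)⁻¹ α β)
      (fun q => Ring.inverse (Γ q)) p) α β).trans (norm_apply_le_linftyOp _ _ _)
    rw [← e] at h2
    simp only [← Matrix.nonsing_inv_eq_ringInverse] at h1 h2 ⊢
    linarith
  · have := norm_dirDeriv_ringInverse_le hΩ hM hu hp hH (hDs γ)
    linarith [hcoef (realDir γ) α β]
  · have := norm_dirDeriv_ringInverse_le hΩ hM hu hp hH hDt
    linarith [hcoef timeDir α β]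

end CoefficientBounds

/-! ### Metrics in charts and changes of coordinates -/

section Charts

variable {n : ℕ} {M : Type*} [TopologicalSpace M] [ChartedSpace (Cn n) M]

theorem isOpen_timeInterval (T : EReal) : IsOpen (timeInterval T) :=
  (isOpen_lt continuous_const continuous_id).inter
    (isOpen_lt continuous_coe_real_ereal continuous_const)

theorem sum_smul_single (w : Cn n) : ∑ i, w i • EuclideanSpace.single i (1 : ℂ) = w := by
  ext j
  simp [Finset.sum_apply, Pi.single_apply]

theorem HermitianMetric.normSq_mfderiv_symm (g : HermitianMetric n M)
    (e : OpenPartialHomeomorph M (Cn n)) (z w : Cn n) :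
    g.normSq (e.symm z) (mfderiv 𝓘(ℂ, Cn n) 𝓘(ℂ, Cn n) e.symm z w) = hermForm (g.coeff e z) w := by
  have hv : mfderiv 𝓘(ℂ, Cn n) 𝓘(ℂ, Cn n) e.symm z w = ∑ i, w i • coordVector e z i := by
    conv_lhs => rw [← sum_smul_single w]
    simp only [coordVector]
    exact (map_sum _ _ _).trans (Finset.sum_congr rfl fun i _ => map_smul _ _ _)
  rw [hv, HermitianMetric.normSq, hermForm]
  congr 1
  rw [map_sum, Finset.sum_comm]
  refine Finset.sum_congr rfl fun j _ => ?_
  rw [map_sum, LinearMap.sum_apply]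
  refine Finset.sum_congr rfl fun i _ => ?_
  rw [map_smulₛₗ, map_smul, LinearMap.smul_apply]
  simp only [HermitianMetric.coeff, formCoeff, Matrix.of_apply, smul_eq_mul]
  ring

theorem HermitianMetric.isHermitian_coeff (g : HermitianMetric n M)
    (e : OpenPartialHomeomorph M (Cn n)) (z : Cn n) : (g.coeff e z).IsHermitian := by
  refine Matrix.IsHermitian.ext fun i j => ?_
  exact g.conj_symm _ _ _

variable [IsManifold 𝓘(ℂ, Cn n) ω M]

theorem isManifold_one : IsManifold 𝓘(ℂ, Cn n) 1 M := IsManifold.of_le (n := ω) le_top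

theorem mdifferentiable_of_atlas {e : OpenPartialHomeomorph M (Cn n)} (he : e ∈ atlas (Cn n) M) :
    e.MDifferentiable 𝓘(ℂ, Cn n) 𝓘(ℂ, Cn n) :=
  have := isManifold_one (n := n) (M := M)
  mdifferentiable_of_mem_atlas he

theorem HermitianMetric.hermForm_coeff_pos (g : HermitianMetric n M)
    {e : OpenPartialHomeomorph M (Cn n)} (he : e ∈ atlas (Cn n) M) {z : Cn n} (hz : z ∈ e.target)
    (w : Fin n → ℂ) (hw : w ≠ 0) : 0 < hermForm (g.coeff e z) w := by
  have := g.normSq_mfderiv_symm e z (WithLp.toLp 2 w)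
  rw [show ((WithLp.toLp 2 w : Cn n) : Fin n → ℂ) = w from rfl] at this
  rw [← this]
  refine g.pos _ _ fun h0 => hw ?_
  have hinj := (mdifferentiable_of_atlas he).symm.mfderiv_injective hz
  have h1 := hinj (h0.trans (map_zero _).symm)
  funext i
  exact congrArg (fun v : Cn n => v i) h1

/-- The differential of a change of coordinates. -/
theorem exists_transition_deriv {e e' : OpenPartialHomeomorph M (Cn n)}
    (he : e ∈ atlas (Cn n) M) (he' : e' ∈ atlas (Cn n) M) {x : M} (hx : x ∈ e.source)
    (hx' : x ∈ e'.source) :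
    ∃ J : Cn n →L[ℂ] Cn n, Function.Surjective J ∧
      (∀ (g : HermitianMetric n M) (w : Cn n),
        hermForm (g.coeff e' (e' x)) w = hermForm (g.coeff e (e x)) (J w)) ∧
      ∀ h : M → ℝ, DifferentiableAt ℝ (fun z => h (e.symm z)) (e x) → ∀ w : Cn n,
        fderiv ℝ (fun z => h (e'.symm z)) (e' x) w =
          fderiv ℝ (fun z => h (e.symm z)) (e x) (J w) := by
  have hd := mdifferentiable_of_atlas he
  have hd' := mdifferentiable_of_atlas he'
  set φ : Cn n → Cn n := fun z => e (e'.symm z) with hφ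
  have hz' : e' x ∈ e'.target := e'.map_source hx'
  have hz : e x ∈ e.target := e.map_source hx
  have hsx : e'.symm (e' x) = x := e'.left_inv hx'
  have hφx : φ (e' x) = e x := by simp [hφ, hsx]
  have hmφ : MDifferentiableAt 𝓘(ℂ, Cn n) 𝓘(ℂ, Cn n) φ (e' x) := by
    have h1 := hd'.mdifferentiableAt_symm hz'
    have h2 : MDifferentiableAt 𝓘(ℂ, Cn n) 𝓘(ℂ, Cn n) e (e'.symm (e' x)) := by
      rw [hsx]; exact hd.mdifferentiableAt hx
    exact h2.comp _ h1
  have hdφ : DifferentiableAt ℂ φ (e' x) := mdifferentiableAt_iff_differentiableAt.1 hmφ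
  have hev : ∀ᶠ z in nhds (e' x), e.symm (φ z) = e'.symm z := by
    have hc : ContinuousAt e'.symm (e' x) := e'.continuousAt_symm hz'
    have : ∀ᶠ z in nhds (e' x), e'.symm z ∈ e.source :=
      hc.eventually (e.open_source.mem_nhds (by rw [hsx]; exact hx))
    exact this.mono fun z hz => e.left_inv hz
  have hmf : mfderiv 𝓘(ℂ, Cn n) 𝓘(ℂ, Cn n) e'.symm (e' x) =
      (mfderiv 𝓘(ℂ, Cn n) 𝓘(ℂ, Cn n) e.symm (φ (e' x))).comp
        (mfderiv 𝓘(ℂ, Cn n) 𝓘(ℂ, Cn n) φ (e' x)) := by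
    rw [← mfderiv_comp (e' x) (by rw [hφx]; exact hd.mdifferentiableAt_symm hz) hmφ]
    exact (Filter.EventuallyEq.mfderiv_eq hev).symm
  refine ⟨fderiv ℂ φ (e' x), ?_, ?_, ?_⟩
  · intro y
    have hinj := hd.symm.mfderiv_injective (x := φ (e' x)) (by rw [hφx]; exact hz)
    obtain ⟨w, hw⟩ := (hd'.symm.mfderiv_surjective hz')
      (mfderiv 𝓘(ℂ, Cn n) 𝓘(ℂ, Cn n) e.symm (φ (e' x)) y)
    refine ⟨w, hinj ?_⟩
    rw [← mfderiv_eq_fderiv]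
    exact (congrArg (fun A : Cn n →L[ℂ] Cn n => A w) hmf).symm.trans hw
  · intro g w
    -- The two base points are equal but not definitionally so; the squared length is transported
    -- along the equality.
    have hpt : ∀ {y y' : M} (_ : y = y') (v : Cn n), g.normSq y v = g.normSq y' v := by
      rintro y _ rfl v; rfl
    rw [← g.normSq_mfderiv_symm e' (e' x) w, ← g.normSq_mfderiv_symm e (e x), ← hφx]
    refine (hpt (y' := e.symm (φ (e' x))) (by rw [hφx, hsx, e.left_inv hx]) _).trans ?_
    rw [← mfderiv_eq_fderiv]
    exact congrArg (fun v : Cn n => g.normSq (e.symm (φ (e' x))) v)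
      (congrArg (fun A : Cn n →L[ℂ] Cn n => A w) hmf)
  · intro h hh w
    have h1 : (fun z => h (e'.symm z)) =ᶠ[nhds (e' x)] (fun z => h (e.symm z)) ∘ φ :=
      hev.mono fun z hz => by simp [hz]
    rw [h1.fderiv_eq]
    rw [← hφx] at hh
    have h2 := (hh.hasFDerivAt.comp (e' x) (hdφ.hasFDerivAt.restrictScalars ℝ)).fderiv
    rw [h2, hφx]
    rfl

end Charts

/-- With `U = exp f`, `Dᵥ D_w U = U (Dᵥ D_w f + Dᵥf D_wf)`; contract with `a` and cancel `U`. -/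
theorem dirDeriv_log_eq {E ι : Type*} [NormedAddCommGroup E] [NormedSpace ℝ E] [Fintype ι]
    {Ω : Set E} {p : E} {b : ι → E} {τ : E} {a : ι → ι → E → ℝ} {U : E → ℝ} (hΩ : IsOpen Ω)
    (hU : ContDiffOn ℝ ∞ U Ω) (hpos : ∀ q ∈ Ω, 0 < U q) (hp : p ∈ Ω)
    (heq : dirDeriv τ U p = ellOp b a U p) :
    dirDeriv τ (fun q => Real.log (U q)) p =
      ellOp b a (fun q => Real.log (U q)) p + gradSq b a (fun q => Real.log (U q)) p := by
  have hf : ContDiffOn ℝ ∞ (fun q => Real.log (U q)) Ω := hU.log fun q hq => (hpos q hq).ne'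
  have h1 : ∀ v, ∀ q ∈ Ω, dirDeriv v U q = U q * dirDeriv v (fun q => Real.log (U q)) q := by
    intro v q hq
    have := fderiv.log (differentiableAt_of_contDiffOn hΩ hU hq) (hpos q hq).ne'
    simp only [dirDeriv, this]
    simp [(hpos q hq).ne']
  have h2 : ∀ v w, dirDeriv v (dirDeriv w U) p = U p * (dirDeriv v (dirDeriv w fun q =>
      Real.log (U q)) p + dirDeriv v (fun q => Real.log (U q)) p
        * dirDeriv w (fun q => Real.log (U q)) p) := by
    intro v w
    rw [dirDeriv_congr hΩ (h1 w) hp, dirDeriv_mul hΩ hU (contDiffOn_dirDeriv hΩ hf w) hp,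
      h1 v p hp]
    ring
  have h3 : ellOp b a U p = U p * (ellOp b a (fun q => Real.log (U q)) p
      + gradSq b a (fun q => Real.log (U q)) p) := by
    simp only [ellOp, gradSq, h2, ← Finset.sum_add_distrib, Finset.mul_sum, smul_eq_mul]
    exact Finset.sum_congr rfl fun k _ => Finset.sum_congr rfl fun l _ => by ring
  rw [h1 τ p hp, h3] at heq
  exact mul_left_cancel₀ (hpos p hp).ne' heq

theorem isOpen_chartDomain {n : ℕ} {M : Type*} [TopologicalSpace M]
    (e : OpenPartialHomeomorph M (Cn n)) (T : EReal) : IsOpen (e.target ×ˢ timeInterval T) :=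
  e.open_target.prod (isOpen_timeInterval T)

/-! ### The logarithm of a solution and its gradient -/

section Solution

variable {n : ℕ} {M : Type*} [TopologicalSpace M] [ChartedSpace (Cn n) M]

/-- The components of a family of metrics in a chart, as a function on space-time. -/
def stCoeff (g' : ℝ → HermitianMetric n M) (e : OpenPartialHomeomorph M (Cn n)) (p : Cn n × ℝ) :
    Matrix (Fin n) (Fin n) ℂ := (g' p.2).coeff e p.1

/-- The real coefficients of the Laplacian of a family of metrics in a chart. -/
def stOp (g' : ℝ → HermitianMetric n M) (e : OpenPartialHomeomorph M (Cn n))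
    (α β : Fin n × Fin 2) (p : Cn n × ℝ) : ℝ := realCoeff (stCoeff g' e p)⁻¹ α β

/-- The logarithm of a function in a chart. -/
def stLog (u : M → ℝ → ℝ) (e : OpenPartialHomeomorph M (Cn n)) (p : Cn n × ℝ) : ℝ :=
  Real.log (u (e.symm p.1) p.2)

theorem hasDerivAt_time_slice {F : Type*} [NormedAddCommGroup F] [NormedSpace ℝ F]
    {h : Cn n × ℝ → F} {z : Cn n} {t : ℝ} (hd : DifferentiableAt ℝ h (z, t)) :
    HasDerivAt (fun s => h (z, s)) (dirDeriv timeDir h (z, t)) t := by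
  have h1 : HasDerivAt (fun s : ℝ => (z, s)) ((0, 1) : Cn n × ℝ) t :=
    (hasDerivAt_const t z).prodMk (hasDerivAt_id t)
  exact hd.hasFDerivAt.comp_hasDerivAt t h1

variable {g' : ℝ → HermitianMetric n M} {T : EReal} {u : M → ℝ → ℝ}
  {e : OpenPartialHomeomorph M (Cn n)}

theorem IsPositiveSolution.contDiffOn_stLog (hu : IsPositiveSolution g' T u)
    (he : e ∈ atlas (Cn n) M) : ContDiffOn ℝ ∞ (stLog u e) (e.target ×ˢ timeInterval T) :=
  (hu.smooth e he).log fun _ hq => (hu.pos _ _ hq.2).ne'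

theorem IsPositiveSolution.dirDeriv_stLog (hu : IsPositiveSolution g' T u)
    (he : e ∈ atlas (Cn n) M) {q : Cn n × ℝ} (hq : q ∈ e.target ×ˢ timeInterval T) :
    dirDeriv timeDir (stLog u e) q =
      ellOp realDir (stOp g' e) (stLog u e) q + gradSq realDir (stOp g' e) (stLog u e) q := by
  have hΩ := isOpen_chartDomain e T
  have hU := hu.smooth e he
  refine dirDeriv_log_eq hΩ hU (fun q hq => hu.pos _ _ hq.2) hq ?_
  obtain ⟨z, t⟩ := q
  have h1 := hu.equation e he z hq.1 t hq.2
  have h2 := (hasDerivAt_time_slice (differentiableAt_of_contDiffOn hΩ hU hq)).deriv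
  simp only at h2
  rw [h2] at h1
  have hUc : ContDiffOn ℝ ∞ (fun p : Cn n × ℝ => ((u (e.symm p.1) p.2 : ℝ) : ℂ))
      (e.target ×ˢ timeInterval T) := Complex.ofRealCLM.contDiff.comp_contDiffOn hU
  have h3 : (g' t).laplacian e (fun x => u x t) z =
      ellOp realDir (stOp g' e) (fun p : Cn n × ℝ => ((u (e.symm p.1) p.2 : ℝ) : ℂ)) (z, t) := by
    rw [← sum_stDz_stDzbar hΩ hUc hq ((g' t).isHermitian_coeff e z).inv fun _ _ => rfl]
    simp only [HermitianMetric.laplacian]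
    refine Finset.sum_congr rfl fun i _ => Finset.sum_congr rfl fun j _ => ?_
    rw [← dz_dzbar_slice hΩ hUc hq]
  have h4 := ellOp_clm Complex.ofRealCLM hΩ hU hq realDir (stOp g' e)
  simp only [Complex.ofRealCLM_apply] at h4
  rw [h3, h4] at h1
  exact_mod_cast h1

variable [IsManifold 𝓘(ℂ, Cn n) ω M]

theorem contDiffOn_stOp (hg' : SmoothFamily g' T) (he : e ∈ atlas (Cn n) M)
    (α β : Fin n × Fin 2) : ContDiffOn ℝ ∞ (stOp g' e α β) (e.target ×ˢ timeInterval T) :=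
  contDiffOn_realCoeff_inv (hg' e he)
    (fun q hq => isUnit_of_hermForm_pos ((g' q.2).hermForm_coeff_pos he hq.1)) α β

/-- Here `df(w) = 2 Re ∑ ζᵢ wᵢ` with `ζᵢ = ∂f/∂zᵢ`, so this is the Legendre duality. Only `df` and
the metric on tangent vectors appear, both natural under coordinate changes. -/
theorem isGreatest_gradSq (hu : IsPositiveSolution g' T u)
    (he : e ∈ atlas (Cn n) M) {z : Cn n} {t : ℝ} (hz : z ∈ e.target) (ht : t ∈ timeInterval T) :
    IsGreatest (Set.range fun w : Cn n => fderiv ℝ (fun z => Real.log (u (e.symm z) t)) z w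
      - hermForm ((g' t).coeff e z) w) (gradSq realDir (stOp g' e) (stLog u e) (z, t)) := by
  have hΩ := isOpen_chartDomain e T
  have hf := hu.contDiffOn_stLog he
  have hq : (z, t) ∈ e.target ×ˢ timeInterval T := ⟨hz, ht⟩
  set ξ : Fin n × Fin 2 → ℝ := fun α => dirDeriv (realDir α) (stLog u e) (z, t) with hξ
  have h1 := isGreatest_dualForm ((g' t).isHermitian_coeff e z) ((g' t).hermForm_coeff_pos he hz)
    fun i => ((ξ (i, 0) : ℂ) - Complex.I * ξ (i, 1)) / 2
  rw [← sum_realCoeff_mul_mul] at h1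
  have h2 : ∀ w : Cn n, fderiv ℝ (fun z => Real.log (u (e.symm z) t)) z w =
      2 * (∑ i, ((ξ (i, 0) : ℂ) - Complex.I * ξ (i, 1)) / 2 * w i).re := by
    intro w
    have e1 := fderiv_slice (differentiableAt_of_contDiffOn hΩ hf hq) w
    have e2 : ((w, 0) : Cn n × ℝ) =
        ∑ i, ((w i).re • realDir (i, 0) + (w i).im • realDir (i, 1)) := by
      refine Prod.ext ?_ ?_
      · simp only [Prod.fst_sum, Prod.fst_add, Prod.smul_fst, realDir, unitDir]
        ext j
        simp [Finset.sum_apply, Pi.single_apply, Finset.sum_add_distrib, Complex.re_add_im]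
      · simp [realDir, Prod.snd_sum]
    refine e1.trans ?_
    rw [e2, dirDeriv, map_sum, Complex.re_sum, Finset.mul_sum]
    refine Finset.sum_congr rfl fun i _ => ?_
    rw [map_add, map_smul, map_smul]
    change (w i).re * ξ (i, 0) + (w i).im * ξ (i, 1) = _
    simp
    ring
  have h3 : (fun w : Cn n => fderiv ℝ (fun z => Real.log (u (e.symm z) t)) z w
      - hermForm ((g' t).coeff e z) w) = (fun w : Fin n → ℂ =>
        2 * (∑ i, ((ξ (i, 0) : ℂ) - Complex.I * ξ (i, 1)) / 2 * w i).re
          - hermForm ((g' t).coeff e z) w) ∘ (fun w : Cn n => (w : Fin n → ℂ)) := by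
    funext w
    simp only [h2, Function.comp]
  rw [h3, Set.range_comp, Function.Surjective.range_eq (fun w => ⟨WithLp.toLp 2 w, rfl⟩),
    Set.image_univ]
  exact h1

/-- The differential of the transition map matches the two families of competitors and is
surjective, so both maxima are over the same set of values. No transformation law for inverse
matrices is needed. -/
theorem gradSq_chart_eq (hu : IsPositiveSolution g' T u) {e' : OpenPartialHomeomorph M (Cn n)}
    (he : e ∈ atlas (Cn n) M) (he' : e' ∈ atlas (Cn n) M) {x : M} (hx : x ∈ e.source)
    (hx' : x ∈ e'.source) {t : ℝ} (ht : t ∈ timeInterval T) :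
    gradSq realDir (stOp g' e) (stLog u e) (e x, t) =
      gradSq realDir (stOp g' e') (stLog u e') (e' x, t) := by
  obtain ⟨J, hJ, hform, hder⟩ := exists_transition_deriv he he' hx hx'
  have hΩ := isOpen_chartDomain e T
  have hq : (e x, t) ∈ e.target ×ˢ timeInterval T := ⟨e.map_source hx, ht⟩
  have hd : DifferentiableAt ℝ (fun z => Real.log (u (e.symm z) t)) (e x) :=
    DifferentiableAt.comp (g := stLog u e) (f := fun z => (z, t)) (e x)
      (differentiableAt_of_contDiffOn hΩ (hu.contDiffOn_stLog he) hq)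
      (differentiableAt_id.prodMk (differentiableAt_const t))
  have h1 := isGreatest_gradSq hu he (e.map_source hx) ht
  have h2 := isGreatest_gradSq hu he' (e'.map_source hx') ht
  have h3 := hder (fun y => Real.log (u y t)) hd
  simp only [hform, h3] at h2
  have h4 := hJ.range_comp fun w : Cn n => fderiv ℝ (fun z => Real.log (u (e.symm z) t)) (e x) w
      - hermForm ((g' t).coeff e (e x)) w
  simp only [Function.comp_def] at h4
  rw [h4] at h2
  exact h1.unique h2

end Solution

/-! ### Comparison of the fixed metric with Euclidean metrics -/

section MetricComparison

variable {n : ℕ} {M : Type*} [TopologicalSpace M] [ChartedSpace (Cn n) M]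

theorem hermForm_smul (Γ : Matrix (Fin n) (Fin n) ℂ) (r : ℝ) (w : Fin n → ℂ) :
    hermForm Γ (r • w) = r ^ 2 * hermForm Γ w := by
  simp only [hermForm]
  rw [← Complex.re_ofReal_mul, Finset.mul_sum]
  congr 1
  refine Finset.sum_congr rfl fun i _ => ?_
  rw [Finset.mul_sum]
  refine Finset.sum_congr rfl fun j _ => ?_
  simp
  ring

theorem exists_hermForm_coeff_le (g : HermitianMetric n M) {e : OpenPartialHomeomorph M (Cn n)}
    (he : e ∈ atlas (Cn n) M) {S : Set (Cn n)} (hS : IsCompact S) (hSe : S ⊆ e.target) :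
    ∃ C : ℝ, 0 < C ∧ ∀ z ∈ S, ∀ w : Fin n → ℂ,
      hermForm (g.coeff e z) w ≤ C * ∑ i, ‖w i‖ ^ 2 := by
  have hc : ∀ i j, ContinuousOn (fun z => g.coeff e z i j) S := fun i j =>
    (g.smooth e he i j).continuousOn.mono hSe
  choose B hB using fun i j => hS.exists_bound_of_continuousOn (hc i j)
  refine ⟨n * (∑ i, ∑ j, |B i j|) + 1, by positivity, fun z hz w => ?_⟩
  have h1 : ∀ i j, ‖g.coeff e z i j‖ ≤ ∑ i, ∑ j, |B i j| := fun i j =>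
    ((hB i j z hz).trans (le_abs_self _)).trans
      ((Finset.single_le_sum (f := fun j => |B i j|) (fun _ _ => abs_nonneg _)
        (Finset.mem_univ j)).trans
      (Finset.single_le_sum (f := fun i => ∑ j, |B i j|)
        (fun _ _ => Finset.sum_nonneg fun _ _ => abs_nonneg _) (Finset.mem_univ i)))
  refine (hermForm_le_of_norm_le h1 w).trans ?_
  have : 0 ≤ ∑ i, ‖w i‖ ^ 2 := Finset.sum_nonneg fun _ _ => sq_nonneg _
  nlinarith

variable [IsManifold 𝓘(ℂ, Cn n) ω M]

/-- The form has a positive minimum on the compact product of `S` with the unit sphere; homogeneity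
gives all vectors. -/
theorem exists_le_hermForm_coeff (g : HermitianMetric n M) {e : OpenPartialHomeomorph M (Cn n)}
    (he : e ∈ atlas (Cn n) M) {S : Set (Cn n)} (hS : IsCompact S) (hSe : S ⊆ e.target) :
    ∃ C : ℝ, 0 < C ∧ ∀ z ∈ S, ∀ w : Fin n → ℂ,
      ∑ i, ‖w i‖ ^ 2 ≤ C * hermForm (g.coeff e z) w := by
  have hc : ∀ i j, ContinuousOn (fun z => g.coeff e z i j) S := fun i j =>
    (g.smooth e he i j).continuousOn.mono hSe
  set Q : Cn n × Cn n → ℝ := fun p => hermForm (g.coeff e p.1) p.2 with hQ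
  have hcompact : IsCompact (S ×ˢ Metric.sphere (0 : Cn n) 1) := hS.prod (isCompact_sphere _ _)
  have hQc : ContinuousOn Q (S ×ˢ Metric.sphere (0 : Cn n) 1) := by
    simp only [hQ, hermForm]
    refine Complex.continuous_re.comp_continuousOn ?_
    refine continuousOn_finsetSum _ fun i _ => continuousOn_finsetSum _ fun j _ => ?_
    refine ContinuousOn.mul
      (ContinuousOn.mul ((hc i j).comp continuousOn_fst fun p hp => hp.1) ?_) ?_
    · fun_prop
    · exact (Complex.continuous_conj.comp
        (by fun_prop : Continuous fun p : Cn n × Cn n => p.2 j)).continuousOn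
  have hpos : ∀ p ∈ S ×ˢ Metric.sphere (0 : Cn n) 1, 0 < Q p := fun p hp => by
    refine g.hermForm_coeff_pos he (hSe hp.1) _ fun h0 => ?_
    have h1 : p.2 = 0 := by ext i; exact congrFun h0 i
    have h2 := hp.2
    rw [h1] at h2
    simp at h2
  obtain ⟨m, hm, hmin⟩ : ∃ m : ℝ, 0 < m ∧ ∀ p ∈ S ×ˢ Metric.sphere (0 : Cn n) 1, m ≤ Q p := by
    rcases (S ×ˢ Metric.sphere (0 : Cn n) 1).eq_empty_or_nonempty with h0 | h0
    -- The product is empty when `S` is empty or `n = 0`; any positive number then serves.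
    · exact ⟨1, one_pos, fun p hp => by simp [h0] at hp⟩
    · obtain ⟨p, hp, hpm⟩ := hcompact.exists_isMinOn h0 hQc
      exact ⟨Q p, hpos p hp, fun q hq => hpm hq⟩
  refine ⟨1 / m, by positivity, fun z hz w => ?_⟩
  set v : Cn n := WithLp.toLp 2 w with hv
  have hnorm : ∑ i, ‖w i‖ ^ 2 = ‖v‖ ^ 2 := by rw [EuclideanSpace.norm_sq_eq]
  rw [hnorm]
  rcases eq_or_ne v 0 with h0 | h0
  · have hw : w = 0 := by
      funext i; exact congrArg (fun v : Cn n => v i) h0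
    rw [h0, hw]; simp [hermForm]
  · have hn : 0 < ‖v‖ := norm_pos_iff.2 h0
    have h1 := hmin (z, ‖v‖⁻¹ • v) ⟨hz, by simp [norm_smul, hn.ne']⟩
    have h2 : Q (z, ‖v‖⁻¹ • v) = (‖v‖⁻¹) ^ 2 * hermForm (g.coeff e z) w :=
      hermForm_smul _ _ _
    rw [h2] at h1
    have h3 : m * ‖v‖ ^ 2 ≤ hermForm (g.coeff e z) w := by
      have := mul_le_mul_of_nonneg_right h1 (sq_nonneg ‖v‖)
      calc m * ‖v‖ ^ 2 ≤ _ := this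
        _ = _ := by field_simp
    rw [one_div, inv_mul_eq_div, le_div_iff₀ hm]
    linarith

theorem exists_coeff_comparison (g : HermitianMetric n M) (𝒰 : CoordCover n M) :
    ∃ C : ℝ, 0 < C ∧ ∀ a, ∀ x ∈ 𝒰.piece a, ∀ w : Fin n → ℂ,
      hermForm (g.coeff (𝒰.chart a) (𝒰.chart a x)) w ≤ C * ∑ i, ‖w i‖ ^ 2 ∧
      ∑ i, ‖w i‖ ^ 2 ≤ C * hermForm (g.coeff (𝒰.chart a) (𝒰.chart a x)) w := by
  have hS : ∀ a, IsCompact (𝒰.chart a '' 𝒰.piece a) := fun a =>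
    (𝒰.isCompact_piece a).image_of_continuousOn
      ((𝒰.chart a).continuousOn.mono (𝒰.piece_subset a))
  have hSe : ∀ a, 𝒰.chart a '' 𝒰.piece a ⊆ (𝒰.chart a).target := by
    rintro a _ ⟨x, hx, rfl⟩
    exact (𝒰.chart a).map_source (𝒰.piece_subset a hx)
  choose C₁ hC₁ h₁ using fun a => exists_hermForm_coeff_le g (𝒰.chart_mem a) (hS a) (hSe a)
  choose C₂ hC₂ h₂ using fun a => exists_le_hermForm_coeff g (𝒰.chart_mem a) (hS a) (hSe a)
  have hsum : 0 ≤ ∑ a, (C₁ a + C₂ a) := Finset.sum_nonneg fun a _ => (add_pos (hC₁ a) (hC₂ a)).le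
  refine ⟨∑ a, (C₁ a + C₂ a) + 1, by positivity, fun a x hx w => ?_⟩
  have hle : C₁ a + C₂ a ≤ ∑ a, (C₁ a + C₂ a) :=
    Finset.single_le_sum (f := fun a => C₁ a + C₂ a)
      (fun a _ => (add_pos (hC₁ a) (hC₂ a)).le) (Finset.mem_univ a)
  have h0 : 0 ≤ ∑ i, ‖w i‖ ^ 2 := Finset.sum_nonneg fun _ _ => sq_nonneg _
  have e1 := h₁ a _ ⟨x, hx, rfl⟩ w
  have e2 := h₂ a _ ⟨x, hx, rfl⟩ w
  have p1 := hC₁ a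
  have p2 := hC₂ a
  have h3 : 0 ≤ hermForm (g.coeff (𝒰.chart a) (𝒰.chart a x)) w := by
    by_contra! hneg
    nlinarith
  constructor
  · exact e1.trans (mul_le_mul_of_nonneg_right (by linarith) h0)
  · exact e2.trans (mul_le_mul_of_nonneg_right (by linarith) h3)

end MetricComparison

/-! ### The gradient estimate on the manifold -/

section GradientEstimate

variable {n : ℕ} {M : Type*} [TopologicalSpace M] [ChartedSpace (Cn n) M]

/-- The Harnack quantity `|∂ log u|² - 2 ∂ₜ log u` on the manifold. -/
def manifoldHarnack (g' : ℝ → HermitianMetric n M) (u : M → ℝ → ℝ) (x : M) (t : ℝ) : ℝ :=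
  harnackQuantity realDir timeDir (stOp g' (chartAt (Cn n) x)) (stLog u (chartAt (Cn n) x))
    (chartAt (Cn n) x x, t)

variable {g' : ℝ → HermitianMetric n M} {T : EReal} {u : M → ℝ → ℝ}
  {e : OpenPartialHomeomorph M (Cn n)}

theorem dirDeriv_timeDir_stLog (hu : IsPositiveSolution g' T u) (he : e ∈ atlas (Cn n) M) {x : M}
    (hx : x ∈ e.source) {t : ℝ} (ht : t ∈ timeInterval T) :
    dirDeriv timeDir (stLog u e) (e x, t) = deriv (fun s => Real.log (u x s)) t := by
  have h := hasDerivAt_time_slice (differentiableAt_of_contDiffOn (isOpen_chartDomain e T)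
    (hu.contDiffOn_stLog he) ⟨e.map_source hx, ht⟩ : DifferentiableAt ℝ (stLog u e) (e x, t))
  simp only [stLog, e.left_inv hx] at h
  exact h.deriv.symm

theorem MetricBound.hermForm_le {g : HermitianMetric n M} {𝒰 : CoordCover n M} {K : ℝ}
    (hb : MetricBound g 𝒰 g' T K) {t : ℝ} (ht : t ∈ timeInterval T)
    (e : OpenPartialHomeomorph M (Cn n)) (z w : Cn n) :
    hermForm ((g' t).coeff e z) w ≤ K * hermForm (g.coeff e z) w := by
  rw [← HermitianMetric.normSq_mfderiv_symm, ← HermitianMetric.normSq_mfderiv_symm]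
  exact hb.upper t ht _ _

theorem MetricBound.le_hermForm {g : HermitianMetric n M} {𝒰 : CoordCover n M} {K : ℝ}
    (hb : MetricBound g 𝒰 g' T K) {t : ℝ} (ht : t ∈ timeInterval T)
    (e : OpenPartialHomeomorph M (Cn n)) (z w : Cn n) :
    hermForm (g.coeff e z) w ≤ K * hermForm ((g' t).coeff e z) w := by
  rw [← HermitianMetric.normSq_mfderiv_symm, ← HermitianMetric.normSq_mfderiv_symm]
  exact hb.lower t ht _ _

variable [IsManifold 𝓘(ℂ, Cn n) ω M]

theorem manifoldHarnack_eq (hu : IsPositiveSolution g' T u) (he : e ∈ atlas (Cn n) M) {x : M}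
    (hx : x ∈ e.source) {t : ℝ} (ht : t ∈ timeInterval T) :
    manifoldHarnack g' u x t =
      harnackQuantity realDir timeDir (stOp g' e) (stLog u e) (e x, t) := by
  have hc := chart_mem_atlas (Cn n) x
  have hs := mem_chart_source (Cn n) x
  rw [manifoldHarnack, harnackQuantity, harnackQuantity, gradSq_chart_eq hu hc he hs hx ht,
    dirDeriv_timeDir_stLog hu hc hs ht, dirDeriv_timeDir_stLog hu he hx ht]

theorem continuousOn_manifoldHarnack (hg' : SmoothFamily g' T) (hu : IsPositiveSolution g' T u) :
    ContinuousOn (fun p : M × ℝ => manifoldHarnack g' u p.1 p.2)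
      (Set.univ ×ˢ timeInterval T) := by
  rintro ⟨x, t⟩ ⟨-, ht⟩
  refine ContinuousAt.continuousWithinAt ?_
  set e := chartAt (Cn n) x with he_def
  have he := chart_mem_atlas (Cn n) x
  have hx := mem_chart_source (Cn n) x
  have hcont := (contDiffOn_harnackQuantity (b := realDir) (τ := timeDir) (isOpen_chartDomain e T)
    (contDiffOn_stOp hg' he) (hu.contDiffOn_stLog he)).continuousOn.continuousAt
      ((isOpen_chartDomain e T).mem_nhds
        (⟨e.map_source hx, ht⟩ : (e x, t) ∈ e.target ×ˢ timeInterval T))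
  have hev : (fun p : M × ℝ => harnackQuantity realDir timeDir (stOp g' e) (stLog u e) (e p.1, p.2))
      =ᶠ[nhds (x, t)] fun p : M × ℝ => manifoldHarnack g' u p.1 p.2 := by
    filter_upwards [(e.open_source.prod (isOpen_timeInterval T)).mem_nhds
      (⟨hx, ht⟩ : (x, t) ∈ e.source ×ˢ timeInterval T)] with p hp
    exact (manifoldHarnack_eq hu he hp.1 hp.2).symm
  refine ContinuousAt.congr ?_ hev
  have hmap : ContinuousAt (fun p : M × ℝ => (e p.1, p.2)) (x, t) :=
    ((e.continuousAt hx).comp continuousAt_fst).prodMk continuousAt_snd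
  exact ContinuousAt.comp (f := fun p : M × ℝ => (e p.1, p.2)) hcont hmap

theorem hermForm_coeff_nonneg (g : HermitianMetric n M) (he : e ∈ atlas (Cn n) M) {z : Cn n}
    (hz : z ∈ e.target) (w : Fin n → ℂ) : 0 ≤ hermForm (g.coeff e z) w := by
  rcases eq_or_ne w 0 with rfl | hw
  · simp [hermForm]
  · exact (g.hermForm_coeff_pos he hz w hw).le

/-- The bound for the Harnack quantity at a maximum point. -/
theorem exists_manifoldHarnack_le_at_max (g : HermitianMetric n M) (𝒰 : CoordCover n M) (K : ℝ) :
    ∃ C B : ℝ, 0 ≤ C ∧ 0 ≤ B ∧ ∀ (T : EReal) (g' : ℝ → HermitianMetric n M) (u : M → ℝ → ℝ),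
      SmoothFamily g' T → MetricBound g 𝒰 g' T K → IsPositiveSolution g' T u →
      ∀ (ε t : ℝ) (x : M), 0 < ε → ε < t → t ∈ timeInterval T → 0 < manifoldHarnack g' u x t →
      (∀ y, manifoldHarnack g' u y t ≤ manifoldHarnack g' u x t) →
      (∀ s ∈ Set.Icc ε t,
        (s - ε) * manifoldHarnack g' u x s ≤ (t - ε) * manifoldHarnack g' u x t) →
      (t - ε) * manifoldHarnack g' u x t ≤ C + B * (t - ε) := by
  obtain ⟨R, hR, hcomp⟩ := exists_coeff_comparison g 𝒰
  -- `K` is an arbitrary real; the positive `K'` makes the comparison constants meaningful.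
  set K' := |K| + 1 with hK'
  have hK'0 : 0 < K' := by positivity
  have hKK' : K ≤ K' := (le_abs_self K).trans (by linarith)
  obtain ⟨c, N, hc, hN, hcoef⟩ := exists_coefficient_bound n (c₀ := 1 / (K' * R)) (c₁ := K' * R)
    (K := K') (by positivity) (by positivity) hK'0.le
  set N' := 2 * (Fintype.card (Fin n × Fin 2) : ℝ) ^ 2 * N
    + 6 * (Fintype.card (Fin n × Fin 2) : ℝ) ^ 4 * N ^ 2 + 1 with hN'
  obtain ⟨C, B, hC, hB, hCB⟩ := exists_harnack_constants (c := c) (N := N') hc (by positivity)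
  refine ⟨C, B, hC, hB, ?_⟩
  intro T g' u hg' hb hu ε t x hε hεt ht hpos hspace htime
  obtain ⟨a, hxa⟩ : ∃ a, x ∈ 𝒰.piece a := by
    have : x ∈ ⋃ a, 𝒰.piece a := by rw [𝒰.cover]; trivial
    simpa using this
  set e := 𝒰.chart a with he_def
  have he : e ∈ atlas (Cn n) M := 𝒰.chart_mem a
  have hx : x ∈ e.source := 𝒰.piece_subset a hxa
  have hz : e x ∈ e.target := e.map_source hx
  set Ω := e.target ×ˢ timeInterval T with hΩdef
  have hΩ : IsOpen Ω := isOpen_chartDomain e T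
  have hp : (e x, t) ∈ Ω := ⟨hz, ht⟩
  have hΓ : ∀ i j, ContDiffOn ℝ ∞ (fun q => stCoeff g' e q i j) Ω := hg' e he
  have hda := contDiffOn_stOp hg' he
  have hdf := hu.contDiffOn_stLog he
  have hHQ := contDiffOn_harnackQuantity (b := realDir) (τ := timeDir) hΩ hda hdf
  obtain ⟨hell, hA, hL, hD, hA'⟩ := hcoef Ω (e x, t) (stCoeff g' e) hΩ hΓ
    (fun q _ => (g' q.2).isHermitian_coeff e q.1)
    (fun q hq => (g' q.2).hermForm_coeff_pos he hq.1) hp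
    (fun w => by
      have h1 := (hcomp a x hxa w).2
      have h2 := hb.le_hermForm ht e (e x) (WithLp.toLp 2 w)
      have h3 := hermForm_coeff_nonneg (g' t) he hz w
      have h4 : hermForm (g.coeff e (e x)) w ≤ K' * hermForm ((g' t).coeff e (e x)) w :=
        h2.trans (mul_le_mul_of_nonneg_right hKK' h3)
      have h5 : ∑ i, ‖w i‖ ^ 2 ≤ (K' * R) * hermForm ((g' t).coeff e (e x)) w := by
        refine h1.trans ((mul_le_mul_of_nonneg_left h4 hR.le).trans (le_of_eq (by ring)))
      rw [one_div, inv_mul_eq_div, div_le_iff₀ (by positivity), mul_comm]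
      exact h5)
    (fun w => by
      have h1 := (hcomp a x hxa w).1
      have h2 := hb.hermForm_le ht e (e x) (WithLp.toLp 2 w)
      have h3 := hermForm_coeff_nonneg g he hz w
      have h4 : hermForm ((g' t).coeff e (e x)) w ≤ K' * hermForm (g.coeff e (e x)) w :=
        h2.trans (mul_le_mul_of_nonneg_right hKK' h3)
      exact h4.trans ((mul_le_mul_of_nonneg_left h1 hK'0.le).trans (le_of_eq (by ring))))
    (fun i j k => by
      have := hb.space_deriv t ht a x hxa i j k
      rw [← dz_slice (differentiableAt_of_contDiffOn hΩ (hΓ i j) hp)]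
      exact this.trans hKK')
    (fun i j k l => by
      have := hb.space_deriv_two t ht a x hxa i j k l
      rw [← dz_dzbar_slice hΩ (hΓ i j) hp]
      exact this.trans hKK')
    (fun i j => by
      have := hb.time_deriv t ht a x hxa i j
      rw [← (hasDerivAt_time_slice (differentiableAt_of_contDiffOn hΩ (hΓ i j) hp)).deriv]
      exact this.trans hKK')
  have hs : 0 < t - ε := sub_pos.2 hεt
  rw [manifoldHarnack_eq hu he hx ht] at hpos ⊢
  refine harnackQuantity_le_at_max hc hN hN' hCB hΩ hda hdf hp
    (fun q hq => hu.dirDeriv_stLog he hq)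
    (fun α β => realCoeff_symm ((g' t).isHermitian_coeff e (e x)).inv α β)
    hell hA hL hD hA' hs hpos ?_ ?_
  · intro v
    -- The line has no time component, so it stays in the slice at time `t`, where `x` is a maximum.
    have hv : (∑ k, v k • realDir k : Cn n × ℝ).2 = 0 := by simp [Prod.snd_sum, realDir]
    set w := (∑ k, v k • realDir k : Cn n × ℝ) with hw
    have hcont : Continuous fun r : ℝ => e x + r • w.1 := by fun_prop
    have hev : ∀ᶠ r : ℝ in nhds 0, e x + r • w.1 ∈ e.target :=
      hcont.continuousAt.eventually (e.open_target.mem_nhds (by simpa using hz))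
    filter_upwards [hev] with r hr
    have h1 : (e x, t) + r • w = (e x + r • w.1, t) := by
      refine Prod.ext rfl ?_
      simp [hv]
    have h2 := hspace (e.symm (e x + r • w.1))
    rw [manifoldHarnack_eq hu he (e.map_target hr) ht, e.right_inv hr,
      manifoldHarnack_eq hu he hx ht] at h2
    simpa [h1] using h2
  · have h1 := hasDerivAt_time_slice (differentiableAt_of_contDiffOn hΩ hHQ hp)
    have h2 := ((hasDerivAt_id t).sub_const ε).mul h1
    have h3 := nonneg_of_hasDerivAt_of_le_left h2 hεt fun s hs => by
      have hsT : s ∈ timeInterval T := ⟨hε.trans_le hs.1,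
        lt_of_le_of_lt (EReal.coe_le_coe_iff.2 hs.2) ht.2⟩
      have := htime s hs
      rw [manifoldHarnack_eq hu he hx hsT, manifoldHarnack_eq hu he hx ht] at this
      simpa using this
    simpa using h3

/-- The gradient estimate for positive solutions. -/
theorem exists_manifoldHarnack_le [CompactSpace M] (g : HermitianMetric n M)
    (𝒰 : CoordCover n M) (K : ℝ) :
    ∃ C B : ℝ, 0 ≤ C ∧ 0 ≤ B ∧ ∀ (T : EReal) (g' : ℝ → HermitianMetric n M) (u : M → ℝ → ℝ),
      SmoothFamily g' T → MetricBound g 𝒰 g' T K → IsPositiveSolution g' T u →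
      ∀ (x : M), ∀ t ∈ timeInterval T, manifoldHarnack g' u x t ≤ C / t + B := by
  obtain ⟨C, B, hC, hB, hmain⟩ := exists_manifoldHarnack_le_at_max g 𝒰 K
  refine ⟨2 * C, B, by positivity, hB, fun T g' u hg' hb hu x t ht => ?_⟩
  have ht0 : 0 < t := ht.1
  -- The solution is uncontrolled near time 0, so the weight starts at `t / 2`; at time `t` it
  -- equals `t / 2`, whence the constant `2C`.
  set ε := t / 2 with hε
  have hε0 : 0 < ε := by positivity
  have hεt : ε < t := by rw [hε]; linarith
  have hsub : Set.Icc ε t ⊆ timeInterval T := fun s hs =>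
    ⟨hε0.trans_le hs.1, lt_of_le_of_lt (EReal.coe_le_coe_iff.2 hs.2) ht.2⟩
  set F : M × ℝ → ℝ := fun p => (p.2 - ε) * manifoldHarnack g' u p.1 p.2 with hF
  have hFc : ContinuousOn F (Set.univ ×ˢ Set.Icc ε t) :=
    ContinuousOn.mul (by fun_prop) ((continuousOn_manifoldHarnack hg' hu).mono
      (Set.prod_mono le_rfl hsub))
  obtain ⟨⟨y, s⟩, hys, hmax⟩ := (isCompact_univ.prod isCompact_Icc).exists_isMaxOn
    ⟨(x, t), ⟨trivial, hεt.le, le_rfl⟩⟩ hFc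
  have hs : s ∈ Set.Icc ε t := hys.2
  have hxt : F (x, t) ≤ F (y, s) := hmax ⟨trivial, hεt.le, le_rfl⟩
  have hgoal : F (x, t) ≤ C + B * (t - ε) := by
    rcases le_or_gt (F (y, s)) 0 with h0 | h0
    · have : 0 ≤ B * (t - ε) := mul_nonneg hB (by linarith)
      linarith
    -- The weight vanishes at time `ε`, so a positive maximum occurs later.
    · have hsε : ε < s := by
        rcases hs.1.eq_or_lt with h | h
        · rw [← h] at h0
          simp [hF] at h0
        · exact h
      have hsε' : 0 < s - ε := sub_pos.2 hsε
      have hpos : 0 < manifoldHarnack g' u y s := pos_of_mul_pos_right h0 hsε'.le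
      have := hmain T g' u hg' hb hu ε s y hε0 hsε (hsub hs) hpos
        (fun y' => le_of_mul_le_mul_left (hmax (a := (y', s)) ⟨trivial, hs⟩) hsε')
        (fun r hr => hmax (a := (y, r)) ⟨trivial, hr.1, hr.2.trans hs.2⟩)
      have h1 : B * (s - ε) ≤ B * (t - ε) := mul_le_mul_of_nonneg_left (by linarith [hs.2]) hB
      exact hxt.trans (this.trans (by linarith))
  simp only [hF] at hgoal
  have h2 : t - ε = t / 2 := by rw [hε]; ring
  rw [h2] at hgoal
  rw [div_add' _ _ _ ht0.ne', le_div_iff₀ ht0]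
  linarith

end GradientEstimate

/-! ### Integration along segments and chaining -/

section Harnack

variable {n : ℕ} {M : Type*} [TopologicalSpace M] [ChartedSpace (Cn n) M]

/-- The Harnack inequality from `x` to `y`, for all metrics bounded by `K` and all positive
solutions. -/
def HarnackBetween (g : HermitianMetric n M) (𝒰 : CoordCover n M) (K A B D : ℝ) (x y : M) : Prop :=
  ∀ (T : EReal) (g' : ℝ → HermitianMetric n M) (u : M → ℝ → ℝ),
    SmoothFamily g' T → MetricBound g 𝒰 g' T K → IsPositiveSolution g' T u →
    ∀ t₁ t₂ : ℝ, 0 < t₁ → t₁ < t₂ → (t₂ : EReal) < T →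
      Real.log (u x t₁) ≤
        Real.log (u y t₂) + D / (t₂ - t₁) + A * Real.log (t₂ / t₁) + B * (t₂ - t₁)

variable {g : HermitianMetric n M} {𝒰 : CoordCover n M} {K A B D D' : ℝ} {x y z : M}

theorem HarnackBetween.mono (h : HarnackBetween g 𝒰 K A B D x y) (hD : D ≤ D') :
    HarnackBetween g 𝒰 K A B D' x y := by
  intro T g' u hg' hb hu t₁ t₂ h1 h12 h2
  have := h T g' u hg' hb hu t₁ t₂ h1 h12 h2
  have h3 : D / (t₂ - t₁) ≤ D' / (t₂ - t₁) := div_le_div_of_nonneg_right hD (by linarith)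
  linarith

/-- Pass through `y` at the midpoint time. The `A` and `B` terms add up exactly over the two halves;
only `D` grows, doubled by the halved time. -/
theorem HarnackBetween.trans (h : HarnackBetween g 𝒰 K A B D x y)
    (h' : HarnackBetween g 𝒰 K A B D' y z) : HarnackBetween g 𝒰 K A B (2 * D + 2 * D') x z := by
  intro T g' u hg' hb hu t₁ t₂ h1 h12 h2
  have hm1 : t₁ < (t₁ + t₂) / 2 := by linarith
  have hm2 : (t₁ + t₂) / 2 < t₂ := by linarith
  have e1 := h T g' u hg' hb hu t₁ ((t₁ + t₂) / 2) h1 hm1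
    (lt_trans (EReal.coe_lt_coe_iff.2 hm2) h2)
  have e2 := h' T g' u hg' hb hu ((t₁ + t₂) / 2) t₂ (h1.trans hm1) hm2 h2
  have hd : t₂ - t₁ ≠ 0 := by linarith
  have d1 : D / ((t₁ + t₂) / 2 - t₁) = 2 * D / (t₂ - t₁) := by
    rw [show (t₁ + t₂) / 2 - t₁ = (t₂ - t₁) / 2 by ring]; field_simp
  have d2 : D' / (t₂ - (t₁ + t₂) / 2) = 2 * D' / (t₂ - t₁) := by
    rw [show t₂ - (t₁ + t₂) / 2 = (t₂ - t₁) / 2 by ring]; field_simp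
  rw [d1, Real.log_div (by linarith) h1.ne'] at e1
  rw [d2, Real.log_div (by linarith) (by linarith)] at e2
  rw [Real.log_div (by linarith) h1.ne', add_div]
  linarith

theorem exists_uniform_harnack [CompactSpace M] [ConnectedSpace M]
    (hloc : ∀ p : M, ∃ D : ℝ, ∃ V : Set M, IsOpen V ∧ p ∈ V ∧
      ∀ x ∈ V, ∀ y ∈ V, HarnackBetween g 𝒰 K A B D x y) :
    ∃ D : ℝ, ∀ x y, HarnackBetween g 𝒰 K A B D x y := by
  -- Neighbourhoods of both endpoints are built into the relation, so that it yields an open cover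
  -- of `M × M` by sets with a common constant.
  set R : M → M → Prop := fun x y => ∃ D : ℝ, ∃ U ∈ nhds x, ∃ V ∈ nhds y,
    ∀ x' ∈ U, ∀ y' ∈ V, HarnackBetween g 𝒰 K A B D x' y' with hR
  have htrans : ∀ x y z, R x y → R y z → R x z := by
    rintro x y z ⟨D, U, hU, V, hV, h⟩ ⟨D', U', hU', W, hW, h'⟩
    exact ⟨2 * D + 2 * D', U, hU, W, hW, fun x' hx' z' hz' =>
      (h x' hx' y (mem_of_mem_nhds hV)).trans (h' y (mem_of_mem_nhds hU') z' hz')⟩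
  have hall : ∀ x y, R x y := by
    intro x y
    refine (isPreconnected_univ.induction₂ (fun x y => R x y ∧ R y x) ?_ ?_ ?_
      (Set.mem_univ x) (Set.mem_univ y)).1
    · intro x _
      obtain ⟨D, V, hV, hx, h⟩ := hloc x
      rw [nhdsWithin_univ]
      filter_upwards [hV.mem_nhds hx] with y hy
      exact ⟨⟨D, V, hV.mem_nhds hx, V, hV.mem_nhds hy, h⟩,
        ⟨D, V, hV.mem_nhds hy, V, hV.mem_nhds hx, h⟩⟩
    · rintro x y z - - - ⟨h1, h2⟩ ⟨h3, h4⟩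
      exact ⟨htrans x y z h1 h3, htrans z y x h4 h2⟩
    · rintro x y - - ⟨h1, h2⟩
      exact ⟨h2, h1⟩
  have hcomp := isCompact_univ.induction_on (X := M × M)
    (p := fun S => ∃ D : ℝ, ∀ p ∈ S, HarnackBetween g 𝒰 K A B D p.1 p.2)
    ⟨0, fun p hp => hp.elim⟩ (fun S S' hSS' ⟨D, h⟩ => ⟨D, fun p hp => h p (hSS' hp)⟩)
    (fun S S' ⟨D, h⟩ ⟨D', h'⟩ => ⟨max D D', fun p hp => hp.elim
      (fun hp => (h p hp).mono (le_max_left _ _)) fun hp => (h' p hp).mono (le_max_right _ _)⟩)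
    (fun p _ => by
      obtain ⟨D, U, hU, V, hV, h⟩ := hall p.1 p.2
      exact ⟨U ×ˢ V, mem_nhdsWithin_of_mem_nhds (prod_mem_nhds hU hV), D,
        fun q hq => h q.1 hq.1 q.2 hq.2⟩)
  obtain ⟨D, h⟩ := hcomp
  exact ⟨D, fun x y => h (x, y) trivial⟩

variable [IsManifold 𝓘(ℂ, Cn n) ω M]

/-- Integration of the gradient estimate along a segment in a chart. -/
theorem log_le_of_gradient_estimate {g' : ℝ → HermitianMetric n M} {T : EReal} {u : M → ℝ → ℝ}
    {e : OpenPartialHomeomorph M (Cn n)} (hu : IsPositiveSolution g' T u)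
    (he : e ∈ atlas (Cn n) M) {C B Q : ℝ} {S : Set (Cn n)} (hS : Convex ℝ S) (hSe : S ⊆ e.target)
    (hest : ∀ x, ∀ t ∈ timeInterval T, manifoldHarnack g' u x t ≤ C / t + B)
    (hQ : ∀ z ∈ S, ∀ t ∈ timeInterval T, ∀ w : Cn n,
      hermForm ((g' t).coeff e z) w ≤ Q * ‖w‖ ^ 2)
    {z₁ z₂ : Cn n} (hz₁ : z₁ ∈ S) (hz₂ : z₂ ∈ S) {t₁ t₂ : ℝ} (h1 : 0 < t₁) (h12 : t₁ < t₂)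
    (h2 : (t₂ : EReal) < T) :
    Real.log (u (e.symm z₁) t₁) ≤ Real.log (u (e.symm z₂) t₂)
      + 2 * Q * ‖z₂ - z₁‖ ^ 2 / (t₂ - t₁) + C / 2 * Real.log (t₂ / t₁) + B / 2 * (t₂ - t₁) := by
  have hd : 0 < t₂ - t₁ := sub_pos.2 h12
  have hΩ := isOpen_chartDomain e T
  set f := stLog u e with hf_def
  have hf := hu.contDiffOn_stLog he
  set ν : Cn n := (t₂ - t₁)⁻¹ • (z₂ - z₁) with hν
  set γ : ℝ → Cn n × ℝ := fun σ => (z₁ + (σ - t₁) • ν, σ) with hγ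
  set κ : ℝ := 2 * Q * ‖ν‖ ^ 2 with hκ
  have hS' : ∀ σ ∈ Set.Icc t₁ t₂, z₁ + (σ - t₁) • ν ∈ S := by
    intro σ hσ
    have := hS.add_smul_sub_mem hz₁ hz₂ (t := (σ - t₁) / (t₂ - t₁))
      ⟨div_nonneg (by linarith [hσ.1]) hd.le, (div_le_one hd).2 (by linarith [hσ.2])⟩
    rwa [div_eq_mul_inv, mul_smul] at this
  have hT : ∀ σ ∈ Set.Icc t₁ t₂, σ ∈ timeInterval T := fun σ hσ =>
    ⟨h1.trans_le hσ.1, lt_of_le_of_lt (EReal.coe_le_coe_iff.2 hσ.2) h2⟩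
  have hmem : ∀ σ ∈ Set.Icc t₁ t₂, γ σ ∈ e.target ×ˢ timeInterval T := fun σ hσ =>
    ⟨hSe (hS' σ hσ), hT σ hσ⟩
  have hγd : ∀ σ, HasDerivAt γ ((ν, 1) : Cn n × ℝ) σ := by
    intro σ
    have : HasDerivAt (fun σ : ℝ => z₁ + (σ - t₁) • ν) ν σ := by
      simpa using (((hasDerivAt_id σ).sub_const t₁).smul_const ν).const_add z₁
    exact this.prodMk (hasDerivAt_id σ)
  -- `φ` adds to `f` along the segment the integral of the allowed decrease, so the inequality
  -- becomes monotonicity of `φ`.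
  set φ : ℝ → ℝ := fun σ => f (γ σ) + C / 2 * Real.log σ + (B / 2 + κ) * σ with hφ
  have hφd : ∀ σ ∈ Set.Icc t₁ t₂, HasDerivAt φ (dirDeriv (ν, 0) f (γ σ) + dirDeriv timeDir f (γ σ)
      + C / 2 * σ⁻¹ + (B / 2 + κ)) σ := by
    intro σ hσ
    have d1 := (differentiableAt_of_contDiffOn hΩ hf
      (hmem σ hσ)).hasFDerivAt.comp_hasDerivAt σ (hγd σ)
    have d2 := (Real.hasDerivAt_log (h1.trans_le hσ.1).ne').const_mul (C / 2)
    have d3 := (hasDerivAt_id σ).const_mul (B / 2 + κ)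
    have d4 : fderiv ℝ f (γ σ) (ν, 1) = dirDeriv (ν, 0) f (γ σ) + dirDeriv timeDir f (γ σ) := by
      rw [dirDeriv, dirDeriv, ← map_add]
      simp [timeDir]
    rw [d4] at d1
    have d5 := (d1.add d2).add d3
    rw [mul_one] at d5
    exact d5
  have hφ0 : ∀ σ ∈ Set.Icc t₁ t₂, 0 ≤ dirDeriv (ν, 0) f (γ σ) + dirDeriv timeDir f (γ σ)
      + C / 2 * σ⁻¹ + (B / 2 + κ) := by
    intro σ hσ
    have hz := hSe (hS' σ hσ)
    -- The competitor `-2ν` gives `df(ν) ≥ -|∂f|²/2 - 2 g'(ν, ν)`, whose gradient term cancels that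
    -- of `f_t ≥ (|∂f|² - C/σ - B)/2`.
    have g1 := (isGreatest_gradSq hu he hz (hT σ hσ)).2 ⟨(-2 : ℝ) • ν, rfl⟩
    have g2 : fderiv ℝ (fun z => Real.log (u (e.symm z) σ)) (z₁ + (σ - t₁) • ν) ((-2 : ℝ) • ν) =
        -2 * dirDeriv (ν, 0) f (γ σ) := by
      rw [map_smul, smul_eq_mul]
      congr 1
      exact fderiv_slice (differentiableAt_of_contDiffOn hΩ hf (hmem σ hσ)) ν
    have g3 : hermForm ((g' σ).coeff e (z₁ + (σ - t₁) • ν)) (((-2 : ℝ) • ν : Cn n)) =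
        4 * hermForm ((g' σ).coeff e (z₁ + (σ - t₁) • ν)) ν := by
      have := hermForm_smul ((g' σ).coeff e (z₁ + (σ - t₁) • ν)) (-2) ν
      norm_num at this ⊢
      exact this
    simp only [g2, g3] at g1
    have g4 := hQ _ (hS' σ hσ) σ (hT σ hσ) ν
    have g5 := hest (e.symm (z₁ + (σ - t₁) • ν)) σ (hT σ hσ)
    rw [manifoldHarnack_eq hu he (e.map_target hz) (hT σ hσ), e.right_inv hz,
      harnackQuantity] at g5
    change gradSq realDir (stOp g' e) f (γ σ) - 2 * dirDeriv timeDir f (γ σ) ≤ _ at g5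
    change _ ≤ gradSq realDir (stOp g' e) f (γ σ) at g1
    rw [div_eq_mul_inv] at g5
    have g6 : κ = 2 * (Q * ‖ν‖ ^ 2) := by rw [hκ]; ring
    linarith
  have hmono : MonotoneOn φ (Set.Icc t₁ t₂) := by
    refine monotoneOn_of_deriv_nonneg (convex_Icc _ _)
      (fun σ hσ => (hφd σ hσ).continuousAt.continuousWithinAt)
      (fun σ hσ => (hφd σ (interior_subset hσ)).differentiableAt.differentiableWithinAt)
      fun σ hσ => ?_
    rw [(hφd σ (interior_subset hσ)).deriv]
    exact hφ0 σ (interior_subset hσ)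
  have hle := hmono ⟨le_rfl, h12.le⟩ ⟨h12.le, le_rfl⟩ h12.le
  have e1 : f (γ t₁) = Real.log (u (e.symm z₁) t₁) := by simp [hγ, hf_def, stLog]
  have e2 : f (γ t₂) = Real.log (u (e.symm z₂) t₂) := by
    have : z₁ + (t₂ - t₁) • ν = z₂ := by
      rw [hν, smul_smul, mul_inv_cancel₀ hd.ne', one_smul]; abel
    simp [hγ, hf_def, stLog, this]
  simp only [hφ, e1, e2] at hle
  have e3 : κ * (t₂ - t₁) = 2 * Q * ‖z₂ - z₁‖ ^ 2 / (t₂ - t₁) := by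
    rw [hκ, hν, norm_smul, norm_inv, Real.norm_of_nonneg hd.le]
    field_simp
  rw [Real.log_div (h1.trans h12).ne' h1.ne', ← e3]
  linarith

theorem exists_local_harnack (hest : ∀ (T : EReal) (g' : ℝ → HermitianMetric n M) (u : M → ℝ → ℝ),
      SmoothFamily g' T → MetricBound g 𝒰 g' T K → IsPositiveSolution g' T u →
      ∀ x, ∀ t ∈ timeInterval T, manifoldHarnack g' u x t ≤ A / t + B) (p : M) :
    ∃ D : ℝ, ∃ V : Set M, IsOpen V ∧ p ∈ V ∧
      ∀ x ∈ V, ∀ y ∈ V, HarnackBetween g 𝒰 K (A / 2) (B / 2) D x y := by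
  set e := chartAt (Cn n) p with he_def
  have he : e ∈ atlas (Cn n) M := chart_mem_atlas (Cn n) p
  have hp : p ∈ e.source := mem_chart_source (Cn n) p
  obtain ⟨r, hr, hball⟩ := Metric.nhds_basis_closedBall.mem_iff.1
    (e.open_target.mem_nhds (e.map_source hp))
  obtain ⟨R, hR, hRle⟩ := exists_hermForm_coeff_le g he (isCompact_closedBall (e p) r) hball
  refine ⟨2 * (|K| * R) * (2 * r) ^ 2, e.source ∩ e ⁻¹' Metric.ball (e p) r,
    e.isOpen_inter_preimage Metric.isOpen_ball, ⟨hp, Metric.mem_ball_self hr⟩, ?_⟩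
  rintro x ⟨hx, hxr⟩ y ⟨hy, hyr⟩ T g' u hg' hb hu t₁ t₂ h1 h12 h2
  have hx' := Metric.ball_subset_closedBall hxr
  have hy' := Metric.ball_subset_closedBall hyr
  have key := log_le_of_gradient_estimate hu he (convex_closedBall (e p) r) hball
    (hest T g' u hg' hb hu) (Q := |K| * R) (fun z hz t ht w => by
      have a1 := hb.hermForm_le ht e z w
      have a2 := hRle z hz w
      have a3 := hermForm_coeff_nonneg g he (hball hz) w
      rw [← EuclideanSpace.norm_sq_eq] at a2
      calc _ ≤ K * hermForm (g.coeff e z) w := a1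
        _ ≤ |K| * hermForm (g.coeff e z) w := mul_le_mul_of_nonneg_right (le_abs_self K) a3
        _ ≤ |K| * (R * ‖w‖ ^ 2) := mul_le_mul_of_nonneg_left a2 (abs_nonneg K)
        _ = _ := by ring) hx' hy' h1 h12 h2
  rw [e.left_inv hx, e.left_inv hy] at key
  have hdist : ‖e y - e x‖ ≤ 2 * r := by
    rw [← dist_eq_norm]
    exact (dist_triangle_right _ _ (e p)).trans (by
      have b1 := Metric.mem_ball.1 hxr
      have b2 := Metric.mem_ball.1 hyr
      linarith)
  have hmono : 2 * (|K| * R) * ‖e y - e x‖ ^ 2 / (t₂ - t₁) ≤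
      2 * (|K| * R) * (2 * r) ^ 2 / (t₂ - t₁) := by
    have : 0 ≤ t₂ - t₁ := by linarith
    gcongr
  linarith

end Harnack

end

end HermitianHarnack

/-! ### The Harnack inequality -/

open HermitianHarnack in
theorem lemma6p3 {n : ℕ} {M : Type*} [TopologicalSpace M] [T2Space M] [CompactSpace M]
    [ConnectedSpace M] [ChartedSpace (Cn n) M] [IsManifold 𝓘(ℂ, Cn n) ω M]
    (g : HermitianMetric n M) (𝒰 : CoordCover n M) (K : ℝ) :
    ∃ C₁ C₂ C₃ : ℝ, ∀ (T : EReal) (g' : ℝ → HermitianMetric n M) (u : M → ℝ → ℝ),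
      SmoothFamily g' T → MetricBound g 𝒰 g' T K → IsPositiveSolution g' T u →
      ∀ t₁ t₂ : ℝ, 0 < t₁ → t₁ < t₂ → (t₂ : EReal) < T →
        (⨆ x, u x t₁) ≤ (⨅ x, u x t₂) * (t₂ / t₁) ^ C₂ *
          Real.exp (C₃ / (t₂ - t₁) + C₁ * (t₂ - t₁)) := by
  obtain ⟨A, B, -, -, hest⟩ := exists_manifoldHarnack_le g 𝒰 K
  obtain ⟨D, hD⟩ := exists_uniform_harnack (exists_local_harnack hest)
  refine ⟨B / 2, A / 2, D, fun T g' u hg' hb hu t₁ t₂ h1 h12 h2 => ?_⟩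
  have ht₁ : t₁ ∈ timeInterval T := ⟨h1, lt_trans (EReal.coe_lt_coe_iff.2 h12) h2⟩
  have ht₂ : t₂ ∈ timeInterval T := ⟨h1.trans h12, h2⟩
  have hq : 0 < t₂ / t₁ := div_pos (h1.trans h12) h1
  have hpt : ∀ x y, u x t₁ ≤ u y t₂ * ((t₂ / t₁) ^ (A / 2) *
      Real.exp (D / (t₂ - t₁) + B / 2 * (t₂ - t₁))) := by
    intro x y
    have := hD x y T g' u hg' hb hu t₁ t₂ h1 h12 h2
    rw [← Real.exp_log (hu.pos x t₁ ht₁), ← Real.exp_log (hu.pos y t₂ ht₂),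
      Real.rpow_def_of_pos hq, ← Real.exp_add, ← Real.exp_add]
    exact Real.exp_le_exp.2 (by linarith)
  -- With the nonnegative factor inside the infimum, the pointwise inequality for all pairs
  -- suffices, as `M` is nonempty.
  rw [mul_assoc, Real.iInf_mul_of_nonneg (by positivity)]
  exact le_ciInf fun y => ciSup_le fun x => hpt x y
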